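/- **Setting.** A (planning) domain $(F,A,\mathcal C,\delta,M)$ consists of a finite set $F$ of propositions, a finite set $A$ of actions, a finite set $\mathcal C$ of compound task names disjoint from $A$, sets $\mathrm{pre}(a),\mathrm{del}(a),\mathrm{add}(a)\subseteq F$ for each $a\in A$ (given by $\delta$), and for each $c\in\mathcal C$ a finite set $M(c)$ of task networks into which $c$ can be decomposed. A task network $(T,\prec^+,\alpha)$ is a finite set $T$ of tasks with a strict partial order $\prec^+$ and a map $\alpha\colon T\to A\cup\mathcal C$; it is primitive if $\alpha(T)\subseteq A$. Decomposing a task $t$ with $\alpha(t)\in\mathcal C$ replaces $t$ by a network from $M(\alpha(t))$ each of whose tasks is related to the other tasks as $t$ was. An action $a$ is executable in a state $s\subseteq F$ if $\mathrm{pre}(a)\subseteq s$, and then yields $(s\setminus\mathrm{del}(a))\cup\mathrm{add}(a)$; an action sequence is executable in $s$ if its actions can be executed consecutively from $s$. A linearization of a primitive network is a total order on its tasks that respects $\prec^+$; it yields an action sequence through $\alpha$. A primitive network $(T',\prec',\alpha')$ is a solution for a network $tn$ and an initial state $s_0$ if it has a linearization whose action sequence is executable in $s_0$, and $tn$ decomposes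 (in zero or more steps) into a primitive network $(T^*,\prec^*,\alpha^*)$ with $T'\subseteq T^*$, with $\alpha'=\alpha^*$ on $T'$, and such that $t\prec^* t'$ and $t'\in T'$ imply $t\in T'$ and $t\prec' t'$. It is a full solution if $T'=T^*$. **Problems.** The input is a domain, a task network $tn$ in it and an initial state $s_0\subseteq F$, together with a target state $s_g\subseteq F$ for State Reachability and a multiset $S$ of actions for Action Executability. - *State Reachability*: is there a solution with a linearization whose action sequence is executable in $s_0$ and yields a state $s\supseteq s_g$? - *Action Executability*: is there a solution with a linearization whose action sequence is executable in $s_0$ and contains every action at least as often as $S$ does? - *Plan Existence*: is there a full solution? The states of the state transition graph are those reachable from $s_0$ by any executable sequence of actions of $A$. The generalized partial order width of a network is the size of a largest antichain of $\prec^+$ among the tasks that are not isolated (a task is isolated if it is incomparable to each other task). **Theorem.** For all constants $k,w\in\mathbb N$, State Reachability, Action Executability and Plan Existence are solvable in polynomial time on the inputs in which the task network $tn$ is primitive and has generalized partial order width at most $w$ and the state transition graph has at most $k$ states. (The algorithm and the polynomial may depend on $k$ and $w$.) -/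

import Mathlib

/-! ## Machine model: while-programs over binary trees, with a step count -/

namespace WhileTree

/-- Data values: finite binary trees. `nil` also plays the role of "false". -/
inductive Data : Type
  | nil : Data
  | cons : Data → Data → Data
  deriving DecidableEq

namespace Data

/-- The size of a value: the number of its nodes. -/
def size : Data → ℕ
  | nil => 1
  | cons a b => a.size + b.size + 1

/-- Left component (`nil` for `nil`). -/
def head : Data → Data
  | nil => nil
  | cons a _ => a

/-- Right component (`nil` for `nil`). -/
def tail : Data → Data
  | nil => nil
  | cons _ b => b

/-- Truth values as trees. -/
def ofBool : Bool → Data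
  | false => nil
  | true => cons nil nil

/-- Lists as right-nested trees. -/
def ofList : List Data → Data
  | [] => nil
  | a :: l => cons a (ofList l)

/-- Natural numbers in unary: the list of `n` copies of `nil`. -/
def ofNat (n : ℕ) : Data := ofList (List.replicate n nil)

end Data

/-- A store assigns a value to each of the program variables `0, 1, 2, …`; a program mentions only
finitely many of them. -/
abbrev Store : Type := ℕ → Data

/-- Expressions without function calls or recursion. -/
inductive Expr : Type
  | var : ℕ → Expr
  | nil : Expr
  | cons : Expr → Expr → Expr
  | head : Expr → Expr
  | tail : Expr → Expr
  | eq : Expr → Expr → Expr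

namespace Expr

/-- The value of an expression. -/
def eval (s : Store) : Expr → Data
  | var x => s x
  | nil => Data.nil
  | cons e f => Data.cons (e.eval s) (f.eval s)
  | head e => (e.eval s).head
  | tail e => (e.eval s).tail
  | eq e f => Data.ofBool (decide (e.eval s = f.eval s))

/-- The cost of evaluating an expression: the sum of the sizes of the values of all its
subexpressions. So no operation is free, and every operation is charged for copying or
reading all the data that it handles. -/
def cost (s : Store) : Expr → ℕ
  | var x => (s x).size
  | nil => 1
  | cons e f => e.cost s + f.cost s + (Data.cons (e.eval s) (f.eval s)).size
  | head e => e.cost s + (e.eval s).head.size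
  | tail e => e.cost s + (e.eval s).tail.size
  | eq e f => e.cost s + f.cost s +
      (Data.ofBool (decide (e.eval s = f.eval s))).size

end Expr

/-- Programs; `loop e c` is "while the value of `e` is not `nil`, do `c`". -/
inductive Cmd : Type
  | skip : Cmd
  | assign : ℕ → Expr → Cmd
  | seq : Cmd → Cmd → Cmd
  | ite : Expr → Cmd → Cmd → Cmd
  | loop : Expr → Cmd → Cmd

/-- `Exec c s s' t`: started in the store `s`, the program `c` halts in the store `s'` after
`t` steps. -/
inductive Exec : Cmd → Store → Store → ℕ → Prop
  | skip (s : Store) : Exec Cmd.skip s s 1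
  | assign (x : ℕ) (e : Expr) (s : Store) :
      Exec (Cmd.assign x e) s (Function.update s x (e.eval s)) (e.cost s + 1)
  | seq {c d : Cmd} {s s' s'' : Store} {t t' : ℕ} :
      Exec c s s' t → Exec d s' s'' t' → Exec (Cmd.seq c d) s s'' (t + t')
  | ite_true {e : Expr} {c d : Cmd} {s s' : Store} {t : ℕ} :
      e.eval s ≠ Data.nil → Exec c s s' t → Exec (Cmd.ite e c d) s s' (e.cost s + 1 + t)
  | ite_false {e : Expr} {c d : Cmd} {s s' : Store} {t : ℕ} :
      e.eval s = Data.nil → Exec d s s' t → Exec (Cmd.ite e c d) s s' (e.cost s + 1 + t)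
  | loop_false {e : Expr} {c : Cmd} {s : Store} :
      e.eval s = Data.nil → Exec (Cmd.loop e c) s s (e.cost s + 1)
  | loop_true {e : Expr} {c : Cmd} {s s' s'' : Store} {t t' : ℕ} :
      e.eval s ≠ Data.nil → Exec c s s' t → Exec (Cmd.loop e c) s' s'' t' →
      Exec (Cmd.loop e c) s s'' (e.cost s + 1 + t + t')

/-- The initial store: the input in variable `0`, and `nil` in all other variables. -/
def initStore (input : Data) : Store := fun x => if x = 0 then input else Data.nil

/-- The decision problem with instances `I`, encoded by `enc`, and yes-instances `Yes` is
solvable in polynomial time on the class `C` of instances: one program decides all instances in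
the class (the answer is "yes" iff variable `0` is not `nil` at the end), in a number
of steps bounded by a polynomial in the size of the encoded instance. -/
def PolyTimeSolvableOn {I : Type} (enc : I → Data) (C Yes : I → Prop) : Prop :=
  ∃ (c : Cmd) (q : Polynomial ℕ), ∀ i : I, C i →
    ∃ (s' : Store) (t : ℕ), Exec c (initStore (enc i)) s' t ∧
      t ≤ q.eval (enc i).size ∧ (s' 0 ≠ Data.nil ↔ Yes i)

end WhileTree

/-! ## Hierarchical task networks -/

namespace HTN

open WhileTree

/-- A (finite) task network with task names in `N`. The tasks are `0, …, size - 1`, `prec` is the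
strict partial order `≺⁺` on them and `name` is the map `α`. -/
structure TaskNetwork (N : Type) where
  size : ℕ
  prec : Fin size → Fin size → Bool
  prec_irrefl : ∀ x, prec x x = false
  prec_trans : ∀ x y z, prec x y = true → prec y z = true → prec x z = true
  name : Fin size → N

/-- A planning domain with propositions `Fin nF`, actions `Fin nA` and compound task
names `Fin nC`. Task names are the elements of the disjoint union `Fin nA ⊕ Fin nC`. -/
structure Domain where
  nF : ℕ
  nA : ℕ
  nC : ℕ
  pre : Fin nA → Finset (Fin nF)
  del : Fin nA → Finset (Fin nF)
  add : Fin nA → Finset (Fin nF)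
  methods : Fin nC → List (TaskNetwork (Fin nA ⊕ Fin nC))

namespace Domain

/-- The task networks in the domain. -/
abbrev Network (D : Domain) : Type := TaskNetwork (Fin D.nA ⊕ Fin D.nC)

/-- States are sets of propositions. -/
abbrev State (D : Domain) : Type := Finset (Fin D.nF)

/-- The state after executing a plan (a sequence of actions) in a state, or `none` if the
plan is not executable there. -/
def run (D : Domain) : D.State → List (Fin D.nA) → Option D.State
  | s, [] => some s
  | s, a :: p => if D.pre a ⊆ s then D.run ((s \ D.del a) ∪ D.add a) p else none

/-- The vertices of the state transition graph for the initial state `s₀`: the states reachable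
from `s₀` by any sequence of actions of the domain. -/
def reachableStates (D : Domain) (s₀ : D.State) : Set D.State :=
  {s | ∃ p : List (Fin D.nA), D.run s₀ p = some s}

variable {D : Domain}

/-- A network is primitive if all its tasks are primitive. -/
def IsPrimitive (tn : D.Network) : Prop :=
  ∀ t, ∃ a : Fin D.nA, tn.name t = Sum.inl a

/-- The order on the tasks after the task `t` of `tn` is replaced by the network `m`: tasks of `m`
are related to the tasks outside `m` as `t` was. -/
def replacePrec (tn m : D.Network) (t : Fin tn.size) :
    {x : Fin tn.size // x ≠ t} ⊕ Fin m.size → {x : Fin tn.size // x ≠ t} ⊕ Fin m.size → Bool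
  | Sum.inl x, Sum.inl y => tn.prec x y
  | Sum.inl x, Sum.inr _ => tn.prec x t
  | Sum.inr _, Sum.inl y => tn.prec t y
  | Sum.inr u, Sum.inr v => m.prec u v

/-- `tn'` arises from `tn` (up to renaming of tasks) by decomposing one compound task `t`, with
name `c`, by one of the methods `m` for `c`. -/
def DecompositionStep (tn tn' : D.Network) : Prop :=
  ∃ (t : Fin tn.size) (c : Fin D.nC) (m : D.Network),
    tn.name t = Sum.inr c ∧ m ∈ D.methods c ∧
    ∃ e : Fin tn'.size ≃ {x : Fin tn.size // x ≠ t} ⊕ Fin m.size,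
      (∀ i, tn'.name i = Sum.elim (fun x => tn.name x.1) m.name (e i)) ∧
      (∀ i j, tn'.prec i j = replacePrec tn m t (e i) (e j))

/-- `tn` decomposes into `tn'` in finitely many (possibly zero) steps. -/
def Decomposes (tn tn' : D.Network) : Prop :=
  Relation.ReflTransGen DecompositionStep tn tn'

/-- A linearization: an enumeration of all the tasks, each exactly once, that respects the
order. -/
def IsLinearization (tn : D.Network) (l : List (Fin tn.size)) : Prop :=
  l.Nodup ∧ (∀ t, t ∈ l) ∧ l.Pairwise (fun x y => tn.prec y x = false)

/-- `l` is a linearization of `tn` whose action sequence is `p`, and `p` is executable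
in `s₀` and yields the state `s`. -/
def Executes (s₀ : D.State) (tn : D.Network) (l : List (Fin tn.size))
    (p : List (Fin D.nA)) (s : D.State) : Prop :=
  IsLinearization tn l ∧ l.map tn.name = p.map Sum.inl ∧ D.run s₀ p = some s

/-- `ι` identifies the tasks of `sol` with a set of tasks of `whole` that is closed under
predecessors, such that `sol` has the same names and at least the same order relations there. -/
def IsPartVia (sol whole : D.Network) (ι : Fin sol.size → Fin whole.size) : Prop :=
  Function.Injective ι ∧
  (∀ x t', whole.prec x (ι t') = true → ∃ t, ι t = x ∧ sol.prec t t' = true) ∧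
  (∀ t, sol.name t = whole.name (ι t))

/-- `sol` is a solution to `(D, tn, s₀)`. -/
def IsSolution (tn : D.Network) (s₀ : D.State) (sol : D.Network) : Prop :=
  IsPrimitive sol ∧
  (∃ l p s, Executes s₀ sol l p s) ∧
  ∃ whole : D.Network, Decomposes tn whole ∧ IsPrimitive whole ∧
    ∃ ι, IsPartVia sol whole ι

/-- `sol` is a full solution to `(D, tn, s₀)`: it contains all the tasks. -/
def IsFullSolution (tn : D.Network) (s₀ : D.State) (sol : D.Network) : Prop :=
  IsPrimitive sol ∧
  (∃ l p s, Executes s₀ sol l p s) ∧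
  ∃ whole : D.Network, Decomposes tn whole ∧ IsPrimitive whole ∧
    ∃ ι, IsPartVia sol whole ι ∧ Function.Surjective ι

end Domain

namespace TaskNetwork

/-- A task is isolated if it is incomparable to each other task. -/
def IsIsolated {N : Type} (tn : TaskNetwork N) (t : Fin tn.size) : Prop :=
  ∀ x, tn.prec t x = false ∧ tn.prec x t = false

open Classical in
/-- The generalized partial order width: the largest size of an antichain of non-isolated
tasks. -/
noncomputable def gpow {N : Type} (tn : TaskNetwork N) : ℕ :=
  (Finset.univ.filter fun B : Finset (Fin tn.size) =>
    (∀ t ∈ B, ¬ tn.IsIsolated t) ∧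
      IsAntichain (fun x y => tn.prec x y = true) (B : Set (Fin tn.size))).sup Finset.card

end TaskNetwork

/-! ## Problem instances -/

/-- A domain, an initial task network in it, and an initial state; this is also the input
of Plan Existence. -/
structure Instance where
  D : Domain
  tn : D.Network
  s₀ : D.State

/-- Input of State Reachability: additionally a target state. -/
structure ReachInstance extends Instance where
  target : D.State

/-- Input of Action Executability: additionally a multiset of actions. -/
structure ActionInstance extends Instance where
  S : Multiset (Fin D.nA)

/-- Is there a full solution? -/
def PlanExistence (I : Instance) : Prop :=
  ∃ sol : I.D.Network, Domain.IsFullSolution I.tn I.s₀ sol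

/-- Is there a solution with an (executable) linearization that yields a state containing the
target state? -/
def StateReachability (I : ReachInstance) : Prop :=
  ∃ sol : I.D.Network, Domain.IsSolution I.tn I.s₀ sol ∧
    ∃ l p s, Domain.Executes I.s₀ sol l p s ∧ I.target ⊆ s

/-- Is there a solution with an (executable) linearization whose action sequence covers the
multiset `S`? -/
def ActionExecutability (I : ActionInstance) : Prop :=
  ∃ sol : I.D.Network, Domain.IsSolution I.tn I.s₀ sol ∧
    ∃ l p s, Domain.Executes I.s₀ sol l p s ∧ I.S ≤ (p : Multiset (Fin I.D.nA))

/-- The primitive instances with at most `k` states in the state transition graph and with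
generalized partial order width at most `w`. -/
def Bounded (k w : ℕ) (I : Instance) : Prop :=
  Domain.IsPrimitive I.tn ∧ (I.D.reachableStates I.s₀).ncard ≤ k ∧ I.tn.gpow ≤ w

/-! ## Encoding of instances as data values -/

/-- The list of the encoded values of a function on `Fin n`. -/
def encFun {n : ℕ} (f : Fin n → Data) : Data := Data.ofList (List.ofFn f)

/-- A subset of `Fin n` as a bit vector of length `n`. -/
def encSet {n : ℕ} (s : Finset (Fin n)) : Data := encFun fun i => Data.ofBool (decide (i ∈ s))

/-- A tagged task name, the index being in unary. -/
def encName {a c : ℕ} : Fin a ⊕ Fin c → Data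
  | Sum.inl i => Data.cons (Data.ofBool false) (Data.ofNat i)
  | Sum.inr i => Data.cons (Data.ofBool true) (Data.ofNat i)

/-- The list of the names of the tasks, and the Boolean matrix of the order. -/
def encNetwork {a c : ℕ} (tn : TaskNetwork (Fin a ⊕ Fin c)) : Data :=
  Data.cons (encFun fun t => encName (tn.name t))
    (encFun fun x => encFun fun y => Data.ofBool (tn.prec x y))

/-- The number of propositions, the table of the actions, and the table of the methods. -/
def encDomain (D : Domain) : Data :=
  Data.cons (Data.ofNat D.nF)
    (Data.cons
      (encFun fun a =>
        Data.cons (encSet (D.pre a)) (Data.cons (encSet (D.del a)) (encSet (D.add a))))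
      (encFun fun c => Data.ofList ((D.methods c).map encNetwork)))

def encInstance (I : Instance) : Data :=
  Data.cons (encDomain I.D) (Data.cons (encNetwork I.tn) (encSet I.s₀))

def encReachInstance (I : ReachInstance) : Data :=
  Data.cons (encInstance I.toInstance) (encSet I.target)

/-- The multiset is given by the multiplicities of all the actions, in unary. -/
def encActionInstance (I : ActionInstance) : Data :=
  Data.cons (encInstance I.toInstance) (encFun fun a => Data.ofNat (I.S.count a))

end HTN

/-!
The theorem has a mathematical and a programming part.

**Why the search space is polynomial.** A primitive network decomposes only into itself, so a
solution amounts to a set of tasks that is closed under predecessors and has been executed in some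
order (`BoundedInstance.Reaches`). An action matters only through its effect on the at most `k`
reachable states, which is one of at most `(k + 1) ^ k` partial functions. Isolated tasks whose
actions have the same effect (tasks of the same kind) are interchangeable
(`Reaches.of_similar`), so the search may be restricted to sets that use the isolated tasks of each
kind in the order of their indices (`Reaches.exists_mem_configs`). Such a canonical configuration
is determined by its state, by the number of its isolated tasks of each kind, and by its
nonisolated tasks. The latter are determined by the maximal ones among them, which form an
antichain of size at most `w`. Hence there are at most `k * (n + 1) ^ w * (n + 1) ^ ((k + 1) ^ k)`
canonical configurations on `n` tasks (`ncard_canonical_le`).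

State Reachability and Plan Existence can be read off from the visited configurations. For Action
Executability, it has to be decided whether the isolated tasks of a configuration can be exchanged
for others of the same kinds such that the multiset is covered. This is a counting condition for
each action and each kind (`CoversUpToExchange`).

**Why the search runs in polynomial time.** `Comp e f` says that a program computes the value
`f g` from the value `e g` in polynomial time, uniformly in an arbitrary index type that carries the
mathematical objects encoded by these values. This relation is closed under pairing, conditionals
and a bounded iteration (`Comp.fold`), hence under list comprehension, bounded quantification,
counting, and breadth-first search through polynomially many points (`Comp.bfs`). So the
mathematical definitions of the conditions above are at the same time their decision procedures.
-/

namespace WhileTree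

/-! ### Functions computable in polynomial time relative to an encoding -/

/-- A polynomial with natural coefficients is monotone. -/
theorem polyEval_mono (q : Polynomial ℕ) {a b : ℕ} (h : a ≤ b) : q.eval a ≤ q.eval b := by
  induction q using Polynomial.induction_on' with
  | add p q hp hq => simpa using Nat.add_le_add hp hq
  | monomial n c => simpa using Nat.mul_le_mul_left c (Nat.pow_le_pow_left h n)

/-- `Comp e f`: the value `f g` is computable in polynomial time from the value `e g`, for all `g`
in the index type `Γ`. The index type carries the mathematical objects (and the hypotheses on them)
that the values stand for. The program gets its argument and leaves its result in variable `0`,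
works for all contents of the other variables, and preserves all variables from some `m` on, so
that a larger program can keep its own data there. -/
def Comp {Γ : Type} (e f : Γ → Data) : Prop :=
  ∃ (c : Cmd) (m : ℕ) (q : Polynomial ℕ), 0 < m ∧ ∀ (g : Γ) (s : Store), s 0 = e g →
    ∃ (s' : Store) (t : ℕ), Exec c s s' t ∧ s' 0 = f g ∧ (∀ x, m ≤ x → s' x = s x) ∧
      t ≤ q.eval (e g).size ∧ (f g).size ≤ q.eval (e g).size

/-- `Decides e p`: the predicate `p` is decidable in polynomial time from the value `e g`. -/
def Decides {Γ : Type} (e : Γ → Data) (p : Γ → Prop) : Prop :=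
  ∃ f : Γ → Data, Comp e f ∧ ∀ g, f g ≠ Data.nil ↔ p g

/-- A natural number that depends on `g` is bounded by a polynomial in the size of `e g`. -/
def PolyBdd {Γ : Type} (e : Γ → Data) (b : Γ → ℕ) : Prop :=
  ∃ q : Polynomial ℕ, ∀ g, b g ≤ q.eval (e g).size

namespace PolyBdd

variable {Γ : Type} {e : Γ → Data} {a b : Γ → ℕ}

theorem mono (hb : PolyBdd e b) (h : ∀ g, a g ≤ b g) : PolyBdd e a :=
  ⟨hb.choose, fun g => (h g).trans (hb.choose_spec g)⟩

theorem const (n : ℕ) : PolyBdd e fun _ => n := ⟨Polynomial.C n, fun g => by simp⟩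

theorem add (ha : PolyBdd e a) (hb : PolyBdd e b) : PolyBdd e fun g => a g + b g :=
  ⟨ha.choose + hb.choose, fun g => by
    simpa using Nat.add_le_add (ha.choose_spec g) (hb.choose_spec g)⟩

theorem mul (ha : PolyBdd e a) (hb : PolyBdd e b) : PolyBdd e fun g => a g * b g :=
  ⟨ha.choose * hb.choose, fun g => by
    simpa using Nat.mul_le_mul (ha.choose_spec g) (hb.choose_spec g)⟩

theorem pow (ha : PolyBdd e a) (n : ℕ) : PolyBdd e fun g => a g ^ n :=
  ⟨ha.choose ^ n, fun g => by
    simpa using Nat.pow_le_pow_left (ha.choose_spec g) n⟩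

theorem size_env : PolyBdd e fun g => (e g).size := ⟨Polynomial.X, fun g => by simp⟩

theorem eval (ha : PolyBdd e a) (q : Polynomial ℕ) : PolyBdd e fun g => q.eval (a g) :=
  ⟨q.comp ha.choose, fun g => by
    simpa [Polynomial.eval_comp] using polyEval_mono q (ha.choose_spec g)⟩

end PolyBdd

namespace Data

theorem size_pos (d : Data) : 0 < d.size := by cases d <;> simp [size]

theorem size_head_le (d : Data) : d.head.size ≤ d.size := by
  cases d <;> simp [head, size]; omega

theorem size_tail_le (d : Data) : d.tail.size ≤ d.size := by
  cases d <;> simp [tail, size]; omega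

theorem size_ofBool_le (b : Bool) : (ofBool b).size ≤ 3 := by cases b <;> simp [ofBool, size]

theorem size_ofList (l : List Data) : (ofList l).size = (l.map fun d => d.size + 1).sum + 1 := by
  induction l with
  | nil => rfl
  | cons a l ih => simp [ofList, size, ih]; omega

theorem length_le_size (l : List Data) : l.length ≤ (ofList l).size := by
  induction l with
  | nil => simp
  | cons a l ih => simp [ofList, size]; omega

theorem size_le_of_mem {l : List Data} {d : Data} (h : d ∈ l) : d.size ≤ (ofList l).size := by
  induction l with
  | nil => simp at h
  | cons a l ih =>
    rcases List.mem_cons.1 h with rfl | h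
    · simp [ofList, size]; omega
    · have := ih h
      simp [ofList, size]; omega

theorem size_ofList_le {l : List Data} {b : ℕ} (h : ∀ d ∈ l, d.size ≤ b) :
    (ofList l).size ≤ l.length * (b + 1) + 1 := by
  induction l with
  | nil => simp [ofList, size]
  | cons a l ih =>
    have h1 := ih fun d hd => h d (List.mem_cons_of_mem _ hd)
    have h2 := h a (List.mem_cons_self ..)
    simp only [ofList, size, List.length_cons]
    nlinarith

theorem size_ofNat (n : ℕ) : (ofNat n).size = 2 * n + 1 := by
  simp [ofNat, size_ofList, size]; omega

theorem ofNat_succ (n : ℕ) : ofNat (n + 1) = cons nil (ofNat n) := rfl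

theorem size_ofList_drop_le (l : List Data) (i : ℕ) :
    (ofList (l.drop i)).size ≤ (ofList l).size := by
  rw [size_ofList, size_ofList]
  have : (l.drop i).Sublist l := List.drop_sublist i l
  have := (this.map fun d => d.size + 1).sum_le_sum (by simp)
  omega

theorem ofList_injective : Function.Injective ofList := by
  intro l
  induction l with
  | nil => intro l' h; cases l' <;> simp_all [ofList]
  | cons a l ih =>
    intro l' h
    cases l' with
    | nil => simp [ofList] at h
    | cons b l' =>
      simp only [ofList, cons.injEq] at h
      rw [h.1, ih h.2]

theorem ofList_eq_nil {l : List Data} : ofList l = nil ↔ l = [] := by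
  cases l <;> simp [ofList]

theorem tail_ofList (l : List Data) : (ofList l).tail = ofList l.tail := by cases l <;> rfl

end Data

namespace Comp

variable {Γ Δ : Type} {e f h : Γ → Data}

theorem polyBdd (hf : Comp e f) : PolyBdd e fun g => (f g).size := by
  obtain ⟨c, m, q, hm, H⟩ := hf
  refine ⟨q, fun g => ?_⟩
  obtain ⟨s', t, -, -, -, -, hs⟩ := H g (fun _ => e g) rfl
  exact hs

theorem reindex (hf : Comp e f) (r : Δ → Γ) : Comp (fun d => e (r d)) fun d => f (r d) := by
  obtain ⟨c, m, q, hm, H⟩ := hf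
  exact ⟨c, m, q, hm, fun d => H (r d)⟩

/-- A single expression in variable `0` is a program. -/
theorem of_expr (E : Expr)
    (hE : ∀ g (s : Store), s 0 = e g → E.eval s = f g)
    (hc : ∃ q : Polynomial ℕ, ∀ g (s : Store), s 0 = e g →
      E.cost s + (f g).size ≤ q.eval (e g).size) : Comp e f := by
  obtain ⟨q, hq⟩ := hc
  refine ⟨Cmd.assign 0 E, 1, q + 1, Nat.one_pos, fun g s hs => ⟨_, _, Exec.assign 0 E s, ?_, ?_,
    ?_, ?_⟩⟩
  · simp [hE g s hs]
  · intro x hx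
    exact Function.update_of_ne (by omega) _ _
  · have := hq g s hs
    simp; omega
  · have := hq g s hs
    simp; omega

theorem id : Comp e e :=
  of_expr (Expr.var 0) (fun g s hs => hs) ⟨2 * Polynomial.X, fun g s hs => by
    simp [Expr.cost, hs]; omega⟩

theorem nil : Comp e fun _ => Data.nil :=
  of_expr Expr.nil (fun g s hs => rfl) ⟨2, fun g s hs => by simp [Expr.cost, Data.size]⟩

theorem comp (hf : Comp e f) (hh : Comp f h) : Comp e h := by
  obtain ⟨c, m, q, hm, H⟩ := hf
  obtain ⟨c', m', q', hm', H'⟩ := hh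
  refine ⟨Cmd.seq c c', max m m', q + q'.comp q, lt_max_of_lt_left hm, fun g s hs => ?_⟩
  obtain ⟨s1, t1, h1, hv1, hf1, ht1, hs1⟩ := H g s hs
  obtain ⟨s2, t2, h2, hv2, hf2, ht2, hs2⟩ := H' g s1 hv1
  have hmono := polyEval_mono q' hs1
  refine ⟨s2, t1 + t2, Exec.seq h1 h2, hv2, fun x hx => ?_, ?_, ?_⟩
  · rw [hf2 x (le_trans (le_max_right _ _) hx), hf1 x (le_trans (le_max_left _ _) hx)]
  · simp [Polynomial.eval_comp]; omega
  · simp [Polynomial.eval_comp]; omega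

/-- The program for `f` is run on a copy of the argument, which is kept for the program for `h`. -/
theorem pair (hf : Comp e f) (hh : Comp e h) : Comp e fun g => Data.cons (f g) (h g) := by
  obtain ⟨c, m, q, hm, H⟩ := hf
  obtain ⟨c', m', q', hm', H'⟩ := hh
  set M := max m m' with hM
  have hmM : m ≤ M := le_max_left _ _
  have hmM' : m' ≤ M := le_max_right _ _
  refine ⟨Cmd.seq (Cmd.assign M (Expr.var 0)) (Cmd.seq c
    (Cmd.seq (Cmd.assign (M + 1) (Expr.var 0)) (Cmd.seq (Cmd.assign 0 (Expr.var M)) (Cmd.seq c'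
      (Cmd.assign 0 (Expr.cons (Expr.var (M + 1)) (Expr.var 0))))))), M + 2,
    3 * Polynomial.X + 5 * q + 5 * q' + 10, by omega, fun g s hs => ?_⟩
  set s1 := Function.update s M (s 0) with hs1
  obtain ⟨s2, t2, h2, hv2, hf2, ht2, hb2⟩ := H g s1 (by
    rw [hs1, Function.update_of_ne (by omega), hs])
  set s3 := Function.update s2 (M + 1) (s2 0) with hs3
  set s4 := Function.update s3 0 (s3 M) with hs4
  have hs2M : s2 M = e g := by rw [hf2 M hmM, hs1, Function.update_self, hs]
  have hs3M : s3 M = e g := by rw [hs3, Function.update_of_ne (by omega), hs2M]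
  have hs40 : s4 0 = e g := by rw [hs4, Function.update_self, hs3M]
  obtain ⟨s5, t5, h5, hv5, hf5, ht5, hb5⟩ := H' g s4 hs40
  have hs5 : s5 (M + 1) = f g := by
    rw [hf5 _ (by omega), hs4, Function.update_of_ne (by omega), hs3, Function.update_self, hv2]
  refine ⟨_, _, Exec.seq (Exec.assign _ _ _) (Exec.seq h2 (Exec.seq (Exec.assign _ _ _)
    (Exec.seq (Exec.assign _ _ _) (Exec.seq h5 (Exec.assign _ _ _))))), ?_, ?_, ?_, ?_⟩
  · simp [Expr.eval, hs5, hv5]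
  · intro x hx
    rw [Function.update_of_ne (by omega), hf5 x (by omega), hs4, Function.update_of_ne (by omega),
      hs3, Function.update_of_ne (by omega), hf2 x (by omega), hs1,
      Function.update_of_ne (by omega)]
  · simp only [Expr.cost, Expr.eval, Data.size, hs5, hv5, hs, hs2M, hv2,
      Function.update_of_ne (show M ≠ M + 1 by omega), Polynomial.eval_add, Polynomial.eval_mul,
      Polynomial.eval_X, Polynomial.eval_ofNat]
    omega
  · simp only [Data.size, Polynomial.eval_add, Polynomial.eval_mul, Polynomial.eval_X,
      Polynomial.eval_ofNat]
    omega

theorem head (hf : Comp e f) : Comp e fun g => (f g).head :=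
  hf.comp <| of_expr (Expr.head (Expr.var 0)) (fun g s hs => by simp [Expr.eval, hs])
    ⟨3 * Polynomial.X, fun g s hs => by
      have := (f g).size_head_le
      simp [Expr.cost, Expr.eval, hs]; omega⟩

theorem tail (hf : Comp e f) : Comp e fun g => (f g).tail :=
  hf.comp <| of_expr (Expr.tail (Expr.var 0)) (fun g s hs => by simp [Expr.eval, hs])
    ⟨3 * Polynomial.X, fun g s hs => by
      have := (f g).size_tail_le
      simp [Expr.cost, Expr.eval, hs]; omega⟩

theorem beq (hf : Comp e f) (hh : Comp e h) :
    Comp e fun g => Data.ofBool (decide (f g = h g)) :=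
  (hf.pair hh).comp <| of_expr (Expr.eq (Expr.head (Expr.var 0)) (Expr.tail (Expr.var 0)))
    (fun g s hs => by simp [Expr.eval, hs, Data.head, Data.tail])
    ⟨6 * Polynomial.X + 6, fun g s hs => by
      have := Data.size_ofBool_le (decide (f g = h g))
      simp [Expr.cost, Expr.eval, hs, Data.head, Data.tail, Data.size]; omega⟩

theorem snd {f' : Γ → Data} (hf : Comp e fun g => Data.cons (f g) (f' g)) : Comp e f' := hf.tail

/-- Both branches are computed, and a conditional then chooses between the two values. -/
theorem ite {p : Γ → Prop} [DecidablePred p] (hp : Decides e p) (hf : Comp e f) (hh : Comp e h) :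
    Comp e fun g => if p g then f g else h g := by
  obtain ⟨b, hb, hbp⟩ := hp
  refine (hb.pair (hf.pair hh)).comp ⟨Cmd.ite (Expr.head (Expr.var 0))
    (Cmd.assign 0 (Expr.head (Expr.tail (Expr.var 0))))
    (Cmd.assign 0 (Expr.tail (Expr.tail (Expr.var 0)))), 1, 6 * Polynomial.X + 6, Nat.one_pos,
    fun g s hs => ?_⟩
  by_cases hg : p g
  · refine ⟨_, _, Exec.ite_true ?_ (Exec.assign _ _ _), ?_, fun x hx => ?_, ?_, ?_⟩
    · simpa [Expr.eval, hs, Data.head] using (hbp g).2 hg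
    · simp [Expr.eval, hs, Data.head, Data.tail, hg]
    · exact Function.update_of_ne (by omega) _ _
    · simp [Expr.cost, Expr.eval, hs, Data.head, Data.tail, Data.size]; omega
    · simp [hg, Data.size]; omega
  · refine ⟨_, _, Exec.ite_false ?_ (Exec.assign _ _ _), ?_, fun x hx => ?_, ?_, ?_⟩
    · simpa [Expr.eval, hs, Data.head] using fun h => hg ((hbp g).1 h)
    · simp [Expr.eval, hs, Data.tail, hg]
    · exact Function.update_of_ne (by omega) _ _
    · simp [Expr.cost, Expr.eval, hs, Data.head, Data.tail, Data.size]; omega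
    · simp [hg, Data.size]; omega

/-- Bounded iteration: `v g i` is the value of the accumulator after the first `i` elements of the
list `l g` have been read. All these values have to be of polynomial size. -/
theorem fold (l : Γ → List Data) (v : Γ → ℕ → Data)
    (hl : Comp e fun g => Data.ofList (l g)) (h0 : Comp e fun g => v g 0)
    (hs : Comp (Γ := Σ g, Fin (l g).length)
      (fun p => Data.cons (e p.1) (Data.cons ((l p.1).get p.2) (v p.1 p.2)))
      (fun p => v p.1 (p.2 + 1)))
    (hb : ∃ b, PolyBdd e b ∧ ∀ g i, i ≤ (l g).length → (v g i).size ≤ b g) :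
    Comp e fun g => v g (l g).length := by
  obtain ⟨b, ⟨qb, hqb⟩, hvb⟩ := hb
  obtain ⟨cl, ml, ql, hml, Hl⟩ := hl
  obtain ⟨c0, m0, q0, hm0, H0⟩ := h0
  obtain ⟨cs, ms, qs, hms, Hs⟩ := hs
  obtain ⟨M, hMl, hM0, hMs⟩ : ∃ M, ml ≤ M ∧ m0 ≤ M ∧ ms ≤ M :=
    ⟨max ml (max m0 ms), by simp, by simp, by simp⟩
  -- Variables `M`, `M + 1` and `M + 2` hold the environment, the rest of the list and the
  -- accumulator; all three programs preserve them.
  set body : Cmd := Cmd.seq (Cmd.assign 0 (Expr.cons (Expr.var M)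
      (Expr.cons (Expr.head (Expr.var (M + 1))) (Expr.var (M + 2)))))
    (Cmd.seq cs (Cmd.seq (Cmd.assign (M + 2) (Expr.var 0))
      (Cmd.assign (M + 1) (Expr.tail (Expr.var (M + 1)))))) with hbody
  -- `R` bounds the cost of one round: the size bounds of the environment, the list and the
  -- accumulator, each charged a constant number of times, and the cost of the step program.
  set R : Polynomial ℕ := 12 * (Polynomial.X + ql + qb + 3) +
    qs.comp (Polynomial.X + ql + qb + 2) with hR
  have hLsize : ∀ g, (Data.ofList (l g)).size ≤ ql.eval (e g).size := fun g => by
    obtain ⟨s', t, -, -, -, -, h⟩ := Hl g (fun _ => e g) rfl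
    exact h
  have loop : ∀ g j i, i + j = (l g).length → ∀ s : Store, s M = e g →
      s (M + 1) = Data.ofList ((l g).drop i) → s (M + 2) = v g i →
      ∃ s' t, Exec (Cmd.loop (Expr.var (M + 1)) body) s s' t ∧ s' (M + 2) = v g (l g).length ∧
        (∀ x, M + 3 ≤ x → s' x = s x) ∧ t ≤ (j + 1) * R.eval (e g).size := by
    intro g j
    have hReval : R.eval (e g).size = 12 * ((e g).size + ql.eval (e g).size +
        qb.eval (e g).size + 3) + qs.eval ((e g).size + ql.eval (e g).size +
        qb.eval (e g).size + 2) := by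
      simp [hR, Polynomial.eval_comp]
    induction j with
    | zero =>
      intro i hi s hM hM1 hM2
      rw [List.drop_eq_nil_of_le (by omega)] at hM1
      refine ⟨s, _, Exec.loop_false ?_, ?_, fun _ _ => rfl, ?_⟩
      · simp [Expr.eval, hM1, Data.ofList]
      · rw [hM2, ← hi]; rfl
      · simp [Expr.cost, hM1, Data.ofList, Data.size, hReval]; omega
    | succ j ih =>
      intro i hi s hM hM1 hM2
      have hil : i < (l g).length := by omega
      have hdrop : (l g).drop i = (l g)[i] :: (l g).drop (i + 1) :=
        List.drop_eq_getElem_cons hil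
      set s1 := Function.update s 0 (Data.cons (e g) (Data.cons ((l g)[i]) (v g i))) with hs1
      obtain ⟨s2, t2, h2, hv2, hf2, ht2, hb2⟩ := Hs ⟨g, i, hil⟩ s1 (by simp [hs1])
      simp only [List.get_eq_getElem] at hv2 ht2 hb2
      set s3 := Function.update s2 (M + 2) (s2 0) with hs3
      set s4 := Function.update s3 (M + 1) (s3 (M + 1)).tail with hs4
      have hs2M1 : s2 (M + 1) = Data.ofList ((l g).drop i) := by
        rw [hf2 _ (by omega), hs1, Function.update_of_ne (by omega), hM1]
      have hs3M1 : s3 (M + 1) = Data.ofList ((l g).drop i) := by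
        rw [hs3, Function.update_of_ne (by omega), hs2M1]
      obtain ⟨s5, t5, h5, hv5, hf5, ht5⟩ := ih (i + 1) (by omega) s4
        (by rw [hs4, Function.update_of_ne (by omega), hs3, Function.update_of_ne (by omega),
          hf2 _ (by omega), hs1, Function.update_of_ne (by omega), hM])
        (by rw [hs4, Function.update_self, hs3M1, hdrop]; rfl)
        (by rw [hs4, Function.update_of_ne (by omega), hs3, Function.update_self, hv2])
      have hev : (Expr.cons (Expr.var M)
          (Expr.cons (Expr.head (Expr.var (M + 1))) (Expr.var (M + 2)))).eval s =
          Data.cons (e g) (Data.cons ((l g)[i]) (v g i)) := by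
        simp only [Expr.eval, hM, hM1, hM2, hdrop, Data.ofList, Data.head]
      have e1 := Exec.assign 0 (Expr.cons (Expr.var M)
        (Expr.cons (Expr.head (Expr.var (M + 1))) (Expr.var (M + 2)))) s
      rw [hev, ← hs1] at e1
      have e4 : Exec (Cmd.assign (M + 1) (Expr.tail (Expr.var (M + 1)))) s3 s4 _ :=
        Exec.assign _ _ _
      refine ⟨s5, _, Exec.loop_true ?_ (Exec.seq e1 (Exec.seq h2 (Exec.seq (Exec.assign _ _ _)
        e4))) h5, hv5, fun x hx => ?_, ?_⟩
      · simp only [Expr.eval, hM1, hdrop, Data.ofList, ne_eq, reduceCtorEq, not_false_eq_true]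
      · rw [hf5 x hx, hs4, Function.update_of_ne (by omega), hs3, Function.update_of_ne (by omega),
          hf2 _ (by omega), hs1, Function.update_of_ne (by omega)]
      · have a1 := hLsize g
        have a2 := (hvb g i hil.le).trans (hqb g)
        have a3 := (hvb g (i + 1) hil).trans (hqb g)
        have a4 := Data.size_ofList_drop_le (l g) i
        have a5 := Data.size_ofList_drop_le (l g) (i + 1)
        have a6 := Data.size_le_of_mem (List.getElem_mem hil)
        have a7 : qs.eval (Data.cons (e g) (Data.cons ((l g)[i]) (v g i))).size ≤
            qs.eval ((e g).size + ql.eval (e g).size + qb.eval (e g).size + 2) :=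
          polyEval_mono _ (by simp only [Data.size]; omega)
        have a8 := Data.size_head_le (Data.ofList ((l g).drop i))
        have a9 := Data.size_tail_le (Data.ofList ((l g).drop i))
        rw [Nat.succ_mul]
        simp only [Expr.cost, Expr.eval, hM, hM1, hM2, hs3M1, hv2, Data.size]
        omega
  refine ⟨Cmd.seq (Cmd.assign M (Expr.var 0)) (Cmd.seq cl (Cmd.seq (Cmd.assign (M + 1)
    (Expr.var 0)) (Cmd.seq (Cmd.assign 0 (Expr.var M)) (Cmd.seq c0 (Cmd.seq
      (Cmd.assign (M + 2) (Expr.var 0)) (Cmd.seq (Cmd.loop (Expr.var (M + 1)) body)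
        (Cmd.assign 0 (Expr.var (M + 2))))))))), M + 3,
    3 * Polynomial.X + 3 * ql + 3 * q0 + 3 * qb + 10 + (ql + 1) * R, by omega, fun g s hs => ?_⟩
  set s1 := Function.update s M (s 0) with hs1
  obtain ⟨s2, t2, h2, hv2, hf2, ht2, hb2⟩ := Hl g s1 (by
    rw [hs1, Function.update_of_ne (by omega), hs])
  set s3 := Function.update s2 (M + 1) (s2 0) with hs3
  set s4 := Function.update s3 0 (s3 M) with hs4
  have hs2M : s2 M = e g := by rw [hf2 M hMl, hs1, Function.update_self, hs]
  have hs3M : s3 M = e g := by rw [hs3, Function.update_of_ne (by omega), hs2M]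
  obtain ⟨s5, t5, h5, hv5, hf5, ht5, hb5⟩ := H0 g s4 (by rw [hs4, Function.update_self, hs3M])
  set s6 := Function.update s5 (M + 2) (s5 0) with hs6
  obtain ⟨s7, t7, h7, hv7, hf7, ht7⟩ := loop g (l g).length 0 (by omega) s6
    (by rw [hs6, Function.update_of_ne (by omega), hf5 _ (by omega), hs4,
      Function.update_of_ne (by omega), hs3M])
    (by rw [hs6, Function.update_of_ne (by omega), hf5 _ (by omega), hs4,
      Function.update_of_ne (by omega), hs3, Function.update_self, hv2]; rfl)
    (by rw [hs6, Function.update_self, hv5])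
  have a2 := (hvb g _ le_rfl).trans (hqb g)
  refine ⟨_, _, Exec.seq (Exec.assign _ _ _) (Exec.seq h2 (Exec.seq (Exec.assign _ _ _)
    (Exec.seq (Exec.assign _ _ _) (Exec.seq h5 (Exec.seq (Exec.assign _ _ _) (Exec.seq h7
      (Exec.assign _ _ _))))))), ?_, fun x hx => ?_, ?_, ?_⟩
  · simp [Expr.eval, hv7]
  · rw [Function.update_of_ne (by omega), hf7 x hx, hs6, Function.update_of_ne (by omega),
      hf5 x (by omega), hs4, Function.update_of_ne (by omega), hs3,
      Function.update_of_ne (by omega), hf2 x (by omega), hs1, Function.update_of_ne (by omega)]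
  · beta_reduce at ht2 hb2 ht5 hb5 hv2 hv5
    have a3 := (Data.length_le_size (l g)).trans hb2
    have a4 : ((l g).length + 1) * R.eval (e g).size ≤
        (ql.eval (e g).size + 1) * R.eval (e g).size := Nat.mul_le_mul_right _ (by omega)
    simp only [Expr.cost, Expr.eval, hs, hv2, hs2M, hv5, hv7,
      Function.update_of_ne (show M ≠ M + 1 by omega), Polynomial.eval_add,
      Polynomial.eval_mul, Polynomial.eval_X, Polynomial.eval_ofNat, Polynomial.eval_one]
    omega
  · simp only [Polynomial.eval_add, Polynomial.eval_mul, Polynomial.eval_X, Polynomial.eval_ofNat]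
    omega

end Comp

/-! ### Lists, bounded quantifiers and counting -/

namespace Data

theorem size_ofList_append (l l' : List Data) :
    (ofList (l ++ l')).size + 1 = (ofList l).size + (ofList l').size := by
  simp [size_ofList]; omega

theorem size_ofList_reverse (l : List Data) : (ofList l.reverse).size = (ofList l).size := by
  simp [size_ofList, List.sum_reverse]

theorem size_ofList_take_le (l : List Data) (i : ℕ) :
    (ofList (l.take i)).size ≤ (ofList l).size := by
  have h := size_ofList_append (l.take i) (l.drop i)
  have h' := size_pos (ofList (l.drop i))
  rw [List.take_append_drop] at h
  omega

theorem size_ofList_flatMap_le {β : Type} {L : List β} {F : β → List Data} {b : ℕ}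
    (h : ∀ x ∈ L, (ofList (F x)).size ≤ b) :
    (ofList (L.flatMap F)).size ≤ L.length * b + 1 := by
  induction L with
  | nil => simp [ofList, size]
  | cons x L ih =>
    have h1 := ih fun y hy => h y (List.mem_cons_of_mem _ hy)
    have h2 := h x (List.mem_cons_self ..)
    have h3 := size_ofList_append (F x) (L.flatMap F)
    rw [List.flatMap_cons, List.length_cons, Nat.succ_mul]
    omega

end Data

/-- The environment `e` extended by a variable whose values are encoded by `eb`. -/
abbrev extend {Γ : Type} (e : Γ → Data) {β : Γ → Type} (eb : ∀ g, β g → Data) :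
    (Σ g, β g) → Data :=
  fun p => Data.cons (e p.1) (eb p.1 p.2)

/-- The encoding of an index that ranges over `Fin (n g)`. -/
abbrev encFin {Γ : Type} (n : Γ → ℕ) : ∀ g, Fin (n g) → Data := fun _ i => Data.ofNat i

namespace Comp

variable {Γ : Type} {e f h : Γ → Data} {β : Γ → Type} {eb : ∀ g, β g → Data}

/-- Weakening: a computed value remains available in an extended environment. -/
theorem lift (hf : Comp e f) : Comp (extend e eb) fun p => f p.1 :=
  (Comp.id (e := extend e eb)).head.comp (hf.reindex Sigma.fst)

theorem var : Comp (extend e eb) fun p => eb p.1 p.2 :=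
  (Comp.id (e := extend e eb)).tail

theorem of_eq (hf : Comp e f) (hfh : ∀ g, f g = h g) : Comp e h := by
  rwa [funext hfh] at hf

/-- Moving the elements of one list one by one to the front of another reverses them. -/
theorem reverse_append {a b : Γ → List Data} (ha : Comp e fun g => Data.ofList (a g))
    (hb : Comp e fun g => Data.ofList (b g)) :
    Comp e fun g => Data.ofList ((a g).reverse ++ b g) := by
  refine (fold a (fun g i => Data.ofList (((a g).take i).reverse ++ b g)) ha ?_ ?_ ?_).of_eq
    fun g => ?_
  · simpa using hb
  · refine Comp.of_eq (Comp.id.tail) fun p => ?_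
    rw [List.take_succ_eq_append_getElem p.2.2, List.reverse_append]
    rfl
  · refine ⟨_, ha.polyBdd.add hb.polyBdd, fun g i hi => ?_⟩
    have h1 := Data.size_ofList_append ((a g).take i).reverse (b g)
    rw [Data.size_ofList_reverse] at h1
    have h2 := Data.size_ofList_take_le (a g) i
    omega
  · simp

theorem reverse {a : Γ → List Data} (ha : Comp e fun g => Data.ofList (a g)) :
    Comp e fun g => Data.ofList (a g).reverse :=
  (ha.reverse_append (b := fun _ => []) Comp.nil).of_eq fun g => by simp

theorem flatMap {L : ∀ g, List (β g)} (hL : Comp e fun g => Data.ofList ((L g).map (eb g)))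
    {F : ∀ g, β g → List Data} (hF : Comp (extend e eb) fun p => Data.ofList (F p.1 p.2)) :
    Comp e fun g => Data.ofList ((L g).flatMap (F g)) := by
  -- New elements go to the front of the accumulator, so the output is collected in reverse.
  suffices H : Comp e fun g => Data.ofList ((L g).flatMap (F g)).reverse from
    H.reverse.of_eq fun g => by simp
  refine (fold (fun g => (L g).map (eb g))
    (fun g i => Data.ofList (((L g).take i).flatMap (F g)).reverse) hL ?_ ?_ ?_).of_eq fun g => ?_
  · exact Comp.nil
  · let r : (Σ g, Fin ((L g).map (eb g)).length) → Σ g, β g :=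
      fun p => ⟨p.1, (L p.1)[p.2.1]'(by simpa using p.2.2)⟩
    have h1 := hF.reindex r
    have h2 : Comp (fun p : Σ g, Fin ((L g).map (eb g)).length =>
        Data.cons (e p.1) (Data.cons (((L p.1).map (eb p.1)).get p.2)
          (Data.ofList (((L p.1).take p.2).flatMap (F p.1)).reverse)))
        (fun p => extend e eb (r p)) :=
      ((Comp.id.head).pair (Comp.id.tail.head)).of_eq fun p => by
        simp [Data.head, Data.tail, r, extend]
    refine ((h2.comp h1).reverse_append Comp.id.tail.tail).of_eq fun p => ?_
    have hp : p.2.1 < (L p.1).length := by simpa using p.2.2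
    rw [List.take_succ_eq_append_getElem hp, List.flatMap_append, List.flatMap_singleton,
      List.reverse_append]
  · obtain ⟨q, hq⟩ := hF.polyBdd
    have hs := hL.polyBdd
    refine ⟨_, ((hs.mul ((((PolyBdd.size_env (e := e)).add hs).add (PolyBdd.const 1)).eval q)).add
      (PolyBdd.const 1)), fun g i hi => ?_⟩
    rw [Data.size_ofList_reverse]
    refine (Data.size_ofList_flatMap_le (b := q.eval ((e g).size +
      (Data.ofList ((L g).map (eb g))).size + 1)) fun x hx => ?_).trans ?_
    · refine (hq ⟨g, x⟩).trans (polyEval_mono q ?_)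
      have := Data.size_le_of_mem (List.mem_map_of_mem (f := eb g) (List.mem_of_mem_take hx))
      simp only [Data.size]
      omega
    · have h1 : ((L g).take i).length ≤ (Data.ofList ((L g).map (eb g))).size := by
        have := Data.length_le_size ((L g).map (eb g))
        simp only [List.length_map] at this
        simp; omega
      exact Nat.add_le_add_right (Nat.mul_le_mul_right _ h1) 1
  · simp

theorem singleton (hf : Comp e f) : Comp e fun g => Data.ofList [f g] := hf.pair Comp.nil

theorem map {L : ∀ g, List (β g)} (hL : Comp e fun g => Data.ofList ((L g).map (eb g)))
    {F : ∀ g, β g → Data} (hF : Comp (extend e eb) fun p => F p.1 p.2) :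
    Comp e fun g => Data.ofList ((L g).map (F g)) :=
  (flatMap (F := fun g b => [F g b]) hL hF.singleton).of_eq fun g => by
    rw [List.map_eq_flatMap]

theorem map_filter {L : ∀ g, List (β g)} (hL : Comp e fun g => Data.ofList ((L g).map (eb g)))
    {p : ∀ g, β g → Prop} [∀ g, DecidablePred (p g)] (hp : Decides (extend e eb) fun x => p x.1 x.2)
    {F : ∀ g, β g → Data} (hF : Comp (extend e eb) fun x => F x.1 x.2) :
    Comp e fun g => Data.ofList (((L g).filter (p g)).map (F g)) := by
  refine (flatMap (F := fun g b => if p g b then [F g b] else []) hL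
    ((ite hp hF.singleton Comp.nil).of_eq fun x => ?_)).of_eq fun g => ?_
  · split_ifs <;> rfl
  · congr 1
    induction L g with
    | nil => rfl
    | cons b l ih =>
      rw [List.flatMap_cons, ih, List.filter_cons]
      by_cases hb : p g b <;> simp [hb]

theorem length {l : Γ → List Data} (hl : Comp e fun g => Data.ofList (l g)) :
    Comp e fun g => Data.ofNat (l g).length :=
  (map (L := l) (eb := fun _ d => d) (F := fun _ _ => Data.nil) (by simpa using hl)
    Comp.nil).of_eq fun g => by simp [Data.ofNat, List.map_const']

theorem drop {l : Γ → List Data} {i : Γ → ℕ} (hl : Comp e fun g => Data.ofList (l g))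
    (hi : Comp e fun g => Data.ofNat (i g)) :
    Comp e fun g => Data.ofList ((l g).drop (i g)) := by
  refine (fold (fun g => List.replicate (i g) Data.nil) (fun g j => Data.ofList ((l g).drop j))
    hi (by simpa using hl) ?_ ⟨_, hl.polyBdd, fun g j _ => Data.size_ofList_drop_le _ _⟩).of_eq
    fun g => by simp
  refine Comp.of_eq (Comp.id.tail.tail.tail) fun p => ?_
  change (Data.ofList _).tail = _
  rw [Data.tail_ofList, List.tail_drop]

/-- Access to a table by an index in unary. -/
theorem get_ofFn {n : Γ → ℕ} {F : ∀ g, Fin (n g) → Data}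
    (hF : Comp e fun g => Data.ofList (List.ofFn (F g))) {i : ∀ g, Fin (n g)}
    (hi : Comp e fun g => Data.ofNat (i g)) : Comp e fun g => F g (i g) :=
  (hF.drop hi).head.of_eq fun g => by
    rw [List.drop_eq_getElem_cons (by simp)]
    simp [Data.ofList, Data.head]

theorem card_of_ofFn {n : Γ → ℕ} {F : ∀ g, Fin (n g) → Data}
    (hF : Comp e fun g => Data.ofList (List.ofFn (F g))) : Comp e fun g => Data.ofNat (n g) :=
  hF.length.of_eq fun g => by simp

theorem range {n : Γ → ℕ} (hn : Comp e fun g => Data.ofNat (n g)) :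
    Comp e fun g => Data.ofList ((List.range (n g)).map Data.ofNat) := by
  -- The accumulator also holds the next number.
  suffices H : Comp e fun g => Data.cons (Data.ofNat (n g))
      (Data.ofList ((List.range (n g)).map Data.ofNat).reverse) from
    H.snd.reverse.of_eq fun g => by simp
  refine (fold (fun g => List.replicate (n g) Data.nil) (fun g i => Data.cons (Data.ofNat i)
    (Data.ofList ((List.range i).map Data.ofNat).reverse)) hn (Comp.nil.pair Comp.nil) ?_ ?_).of_eq
    fun g => by simp
  · refine Comp.of_eq ((Comp.nil.pair Comp.id.tail.tail.head).pair Comp.id.tail.tail) fun p => ?_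
    simp [Data.head, Data.tail, Data.ofNat_succ, List.range_succ, Data.ofList]
  · have hs := hn.polyBdd
    refine ⟨_, hs.add ((hs.mul (hs.add (PolyBdd.const 1))).add (PolyBdd.const 2)), fun g i hi => ?_⟩
    rw [List.length_replicate] at hi
    have h1 : (Data.ofList ((List.range i).map Data.ofNat).reverse).size ≤
        i * ((Data.ofNat (n g)).size + 1) + 1 := by
      refine (Data.size_ofList_le (b := (Data.ofNat (n g)).size) fun d hd => ?_).trans (by simp)
      simp only [List.mem_reverse, List.mem_map, List.mem_range] at hd
      obtain ⟨j, hj, rfl⟩ := hd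
      simp only [Data.size_ofNat]; omega
    have h2 : i ≤ (Data.ofNat (n g)).size := by rw [Data.size_ofNat]; omega
    have h3 := Nat.mul_le_mul_right ((Data.ofNat (n g)).size + 1) h2
    have h4 : (Data.ofNat i).size ≤ (Data.ofNat (n g)).size := by
      simp only [Data.size_ofNat]; omega
    simp only [Data.size]
    omega

theorem finRange {n : Γ → ℕ} (hn : Comp e fun g => Data.ofNat (n g)) :
    Comp e fun g => Data.ofList ((List.finRange (n g)).map (encFin n g)) :=
  hn.range.of_eq fun g => by
    rw [← List.map_coe_finRange_eq_range, List.map_map]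
    rfl

theorem ofFn {n : Γ → ℕ} (hn : Comp e fun g => Data.ofNat (n g)) {F : ∀ g, Fin (n g) → Data}
    (hF : Comp (extend e (encFin n)) fun p => F p.1 p.2) :
    Comp e fun g => Data.ofList (List.ofFn (F g)) :=
  (map hn.finRange hF).of_eq fun g => by rw [List.ofFn_eq_map]

theorem sub {a b : Γ → ℕ} (ha : Comp e fun g => Data.ofNat (a g))
    (hb : Comp e fun g => Data.ofNat (b g)) : Comp e fun g => Data.ofNat (a g - b g) :=
  (drop ha hb).of_eq fun g => by simp [Data.ofNat]

theorem sum {n : Γ → ℕ} (hn : Comp e fun g => Data.ofNat (n g)) {a : ∀ g, Fin (n g) → ℕ}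
    (ha : Comp (extend e (encFin n)) fun p => Data.ofNat (a p.1 p.2)) :
    Comp e fun g => Data.ofNat (∑ i, a g i) := by
  refine (flatMap hn.finRange (F := fun g i => List.replicate (a g i) Data.nil) ha).of_eq
    fun g => ?_
  rw [Data.ofNat, ← List.sum_ofFn, List.ofFn_eq_map]
  congr 1
  induction List.finRange (n g) with
  | nil => rfl
  | cons i l ih => simp [ih, List.replicate_append_replicate]

theorem ofNat_const (n : ℕ) : Comp e fun _ => Data.ofNat n := by
  induction n with
  | zero => exact Comp.nil
  | succ n ih => exact Comp.nil.pair ih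

end Comp

namespace Decides

variable {Γ : Type} {e f h : Γ → Data} {β : Γ → Type} {eb : ∀ g, β g → Data} {p q : Γ → Prop}

theorem congr (hp : Decides e p) (hpq : ∀ g, p g ↔ q g) : Decides e q := by
  rwa [funext fun g => propext (hpq g)] at hp

theorem eq (hf : Comp e f) (hh : Comp e h) : Decides e fun g => f g = h g :=
  ⟨_, hf.beq hh, fun g => by by_cases hg : f g = h g <;> simp [hg, Data.ofBool]⟩

theorem eq_of_injective {δ : Γ → Type} {E : ∀ g, δ g → Data} (hE : ∀ g, Function.Injective (E g))
    {a b : ∀ g, δ g} (ha : Comp e fun g => E g (a g)) (hb : Comp e fun g => E g (b g)) :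
    Decides e fun g => a g = b g :=
  (eq ha hb).congr fun g => (hE g).eq_iff

theorem ofBool {b : Γ → Bool} (hb : Comp e fun g => Data.ofBool (b g)) :
    Decides e fun g => b g = true :=
  ⟨_, hb, fun g => by cases h : b g <;> simp [Data.ofBool, h]⟩

theorem not (hp : Decides e p) : Decides e fun g => ¬ p g := by
  classical
  exact ⟨_, Comp.ite hp Comp.nil (Comp.nil.pair Comp.nil), fun g => by
    by_cases hg : p g <;> simp [hg]⟩

theorem and (hp : Decides e p) (hq : Decides e q) : Decides e fun g => p g ∧ q g := by
  classical
  obtain ⟨f, hf, hfq⟩ := hq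
  exact ⟨_, Comp.ite hp hf Comp.nil, fun g => by by_cases hg : p g <;> simp [hg, hfq]⟩

theorem or (hp : Decides e p) (hq : Decides e q) : Decides e fun g => p g ∨ q g :=
  (hp.not.and hq.not).not.congr fun g => by tauto

theorem imp (hp : Decides e p) (hq : Decides e q) : Decides e fun g => p g → q g :=
  (hp.not.or hq).congr fun g => by tauto

theorem iff (hp : Decides e p) (hq : Decides e q) : Decides e fun g => p g ↔ q g :=
  ((hp.imp hq).and (hq.imp hp)).congr fun g => by tauto

theorem exists_mem {L : ∀ g, List (β g)} (hL : Comp e fun g => Data.ofList ((L g).map (eb g)))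
    {p : ∀ g, β g → Prop} (hp : Decides (extend e eb) fun x => p x.1 x.2) :
    Decides e fun g => ∃ b ∈ L g, p g b := by
  classical
  refine ⟨_, Comp.map_filter hL hp (F := fun _ _ => Data.nil) Comp.nil, fun g => ?_⟩
  rw [Ne, Data.ofList_eq_nil, List.map_eq_nil_iff, List.filter_eq_nil_iff]
  simp

theorem forall_mem {L : ∀ g, List (β g)} (hL : Comp e fun g => Data.ofList ((L g).map (eb g)))
    {p : ∀ g, β g → Prop} (hp : Decides (extend e eb) fun x => p x.1 x.2) :
    Decides e fun g => ∀ b ∈ L g, p g b :=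
  (exists_mem hL (p := fun g b => ¬ p g b) hp.not).not.congr fun g => by simp

theorem forall_fin {n : Γ → ℕ} (hn : Comp e fun g => Data.ofNat (n g))
    {p : ∀ g, Fin (n g) → Prop} (hp : Decides (extend e (encFin n)) fun x => p x.1 x.2) :
    Decides e fun g => ∀ i, p g i :=
  (forall_mem hn.finRange hp).congr fun g => by simp

theorem le {a b : Γ → ℕ} (ha : Comp e fun g => Data.ofNat (a g))
    (hb : Comp e fun g => Data.ofNat (b g)) : Decides e fun g => a g ≤ b g :=
  (eq (ha.sub hb) Comp.nil).congr fun g => by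
    rw [Data.ofNat, Data.ofList_eq_nil]
    simp [Nat.sub_eq_zero_iff_le]

end Decides

/-- The number of indices that satisfy a decidable predicate. -/
theorem Comp.card_filter {Γ : Type} {e : Γ → Data} {n : Γ → ℕ}
    (hn : Comp e fun g => Data.ofNat (n g)) {p : ∀ g, Fin (n g) → Prop}
    [∀ g, DecidablePred (p g)] (hp : Decides (extend e (encFin n)) fun x => p x.1 x.2) :
    Comp e fun g => Data.ofNat (Finset.univ.filter (p g)).card :=
  (Comp.sum hn (a := fun g i => if p g i then 1 else 0)
    ((Comp.ite hp (Comp.ofNat_const 1) (Comp.ofNat_const 0)).of_eq fun x => by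
      split_ifs <;> rfl)).of_eq fun g => by rw [Finset.card_filter]

/-! ### Breadth-first search -/

section Search

variable {β : Type} [DecidableEq β]

/-- The elements of `xs` are added to the list `L`, without repetitions. -/
def insertAll (L xs : List β) : List β := xs.foldl (fun L x => if x ∈ L then L else x :: L) L

theorem insertAll_append_singleton (L xs : List β) (x : β) :
    insertAll L (xs ++ [x]) =
      if x ∈ insertAll L xs then insertAll L xs else x :: insertAll L xs := by
  rw [insertAll, List.foldl_append]
  rfl

theorem mem_insertAll {L xs : List β} {b : β} : b ∈ insertAll L xs ↔ b ∈ L ∨ b ∈ xs := by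
  induction xs using List.reverseRecOn generalizing b with
  | nil => simp [insertAll]
  | append_singleton xs x ih =>
    rw [insertAll_append_singleton]
    split_ifs with h
    · rw [ih] at h
      rw [ih]
      simp only [List.mem_append, List.mem_singleton]
      constructor
      · tauto
      · rintro (h' | h' | rfl) <;> tauto
    · simp only [List.mem_cons, ih, List.mem_append, List.not_mem_nil, or_false]
      tauto

theorem nodup_insertAll {L : List β} (hL : L.Nodup) (xs : List β) : (insertAll L xs).Nodup := by
  induction xs using List.reverseRecOn with
  | nil => simpa [insertAll]
  | append_singleton xs x ih =>
    rw [insertAll_append_singleton]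
    split_ifs with h
    · exact ih
    · exact List.nodup_cons.2 ⟨h, ih⟩

/-- The points that are reached from `x` in at most `n` steps to a successor. -/
def bfs (succ : β → List β) (x : β) : ℕ → List β
  | 0 => [x]
  | n + 1 => insertAll (bfs succ x n) ((bfs succ x n).flatMap succ)

variable {succ : β → List β} {x b c : β} {n N : ℕ}

theorem nodup_bfs (succ : β → List β) (x : β) (n : ℕ) : (bfs succ x n).Nodup := by
  induction n with
  | zero => simp [bfs]
  | succ n ih => exact nodup_insertAll ih _

theorem mem_bfs_succ (hb : b ∈ bfs succ x n) (hc : c ∈ succ b) :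
    c ∈ bfs succ x (n + 1) :=
  mem_insertAll.2 (Or.inr (List.mem_flatMap.2 ⟨b, hb, hc⟩))

theorem bfs_mono {m : ℕ} (h : m ≤ n) (hb : b ∈ bfs succ x m) : b ∈ bfs succ x n := by
  induction h with
  | refl => exact hb
  | step _ ih => exact mem_insertAll.2 (Or.inl ih)

theorem forall_mem_bfs {P : β → Prop} (hx : P x) (hP : ∀ b, P b → ∀ c ∈ succ b, P c) :
    ∀ b ∈ bfs succ x n, P b := by
  induction n with
  | zero => simpa [bfs]
  | succ n ih =>
    intro b hb
    rcases mem_insertAll.1 hb with hb | hb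
    · exact ih b hb
    · obtain ⟨a, ha, hb⟩ := List.mem_flatMap.1 hb
      exact hP a (ih a ha) b hb

/-- If there are at most `N` points that can be reached at all, then `N` rounds suffice: a round
that adds nothing shows that the list is closed. -/
theorem mem_bfs_of_ncard_le {P : β → Prop} (hx : P x) (hP : ∀ b, P b → ∀ c ∈ succ b, P c)
    (hfin : {b | P b}.Finite) (hN : {b | P b}.ncard ≤ N)
    (hb : Relation.ReflTransGen (fun a c => c ∈ succ a) x b) : b ∈ bfs succ x N := by
  by_cases hst : ∃ n ≤ N, ∀ b ∈ bfs succ x n, ∀ c ∈ succ b, c ∈ bfs succ x n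
  · obtain ⟨n, hn, hst⟩ := hst
    refine bfs_mono hn ?_
    induction hb with
    | refl => exact bfs_mono (Nat.zero_le n) (by simp [bfs])
    | tail _ hc ih => exact hst _ ih _ hc
  · push Not at hst
    have hlen : ∀ n ≤ N + 1, n + 1 ≤ (bfs succ x n).length := by
      intro n
      induction n with
      | zero => simp [bfs]
      | succ n ih =>
        intro hn
        obtain ⟨a, ha, c, hc, hcn⟩ := hst n (by omega)
        have h1 : (c :: bfs succ x n).Nodup :=
          List.nodup_cons.2 ⟨hcn, nodup_bfs succ x n⟩
        have h2 : (c :: bfs succ x n) ⊆ bfs succ x (n + 1) := by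
          intro d hd
          rcases List.mem_cons.1 hd with rfl | hd
          · exact mem_bfs_succ ha hc
          · exact bfs_mono (Nat.le_succ n) hd
        have h3 := (List.subperm_of_subset h1 h2).length_le
        have := ih (by omega)
        simp only [List.length_cons] at h3
        omega
    have h1 := hlen N (by omega)
    have h2 : ((bfs succ x N).toFinset : Set β) ⊆ {b | P b} := fun b hb =>
      forall_mem_bfs hx hP b (by simpa using hb)
    have h3 := Set.ncard_le_ncard h2 hfin
    rw [Set.ncard_coe_finset, List.toFinset_card_of_nodup (nodup_bfs succ x N)] at h3
    omega

end Search

namespace Comp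

variable {Γ : Type} {e : Γ → Data} {β : Γ → Type} [∀ g, DecidableEq (β g)] {eb : ∀ g, β g → Data}
  {P : ∀ g, β g → Prop}

theorem insertAll (hinj : ∀ g, Function.Injective (eb g))
    (hB : ∃ B, PolyBdd e B ∧ ∀ g (L : List (β g)), L.Nodup → (∀ b ∈ L, P g b) →
      (Data.ofList (L.map (eb g))).size ≤ B g)
    {L xs : ∀ g, List (β g)} (hL : Comp e fun g => Data.ofList ((L g).map (eb g)))
    (hxs : Comp e fun g => Data.ofList ((xs g).map (eb g)))
    (hLn : ∀ g, (L g).Nodup) (hLP : ∀ g, ∀ b ∈ L g, P g b) (hxsP : ∀ g, ∀ b ∈ xs g, P g b) :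
    Comp e fun g => Data.ofList ((WhileTree.insertAll (L g) (xs g)).map (eb g)) := by
  obtain ⟨B, hB, hLB⟩ := hB
  refine (fold (fun g => (xs g).map (eb g))
    (fun g i => Data.ofList ((WhileTree.insertAll (L g) ((xs g).take i)).map (eb g))) hxs
    (by simpa [WhileTree.insertAll] using hL) ?_ ?_).of_eq fun g => by simp
  · let E : (Σ g, Fin ((xs g).map (eb g)).length) → Data := fun p =>
      Data.cons (e p.1) (Data.cons (((xs p.1).map (eb p.1)).get p.2)
        (Data.ofList ((WhileTree.insertAll (L p.1) ((xs p.1).take p.2)).map (eb p.1))))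
    have hacc : Comp E fun p =>
        Data.ofList ((WhileTree.insertAll (L p.1) ((xs p.1).take p.2)).map (eb p.1)) :=
      Comp.id.tail.tail
    have hel : Comp E fun p => ((xs p.1).map (eb p.1)).get p.2 := Comp.id.tail.head
    have hmem := Decides.exists_mem (Γ := Σ g, Fin ((xs g).map (eb g)).length)
      (β := fun p => β p.1) (eb := fun p => eb p.1) hacc
      (p := fun p b => eb p.1 b = ((xs p.1).map (eb p.1)).get p.2)
      (Decides.eq Comp.var hel.lift)
    refine (ite (p := fun p : Σ g, Fin ((xs g).map (eb g)).length =>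
      (xs p.1)[p.2.1]'(by simpa using p.2.2) ∈ WhileTree.insertAll (L p.1) ((xs p.1).take p.2))
      (hmem.congr fun p => ?_) hacc (hel.pair hacc)).of_eq fun p => ?_
    · simp only [List.get_eq_getElem, List.getElem_map, (hinj p.1).eq_iff]
      constructor
      · rintro ⟨b, hb, rfl⟩
        exact hb
      · exact fun h => ⟨_, h, rfl⟩
    · have hp : p.2.1 < (xs p.1).length := by simpa using p.2.2
      rw [List.take_succ_eq_append_getElem hp, insertAll_append_singleton]
      split_ifs
      · rfl
      · simp [Data.ofList]
  · refine ⟨B, hB, fun g i _ => hLB g _ (nodup_insertAll (hLn g) _) fun b hb => ?_⟩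
    rcases mem_insertAll.1 hb with hb | hb
    · exact hLP g b hb
    · exact hxsP g b (List.mem_of_mem_take hb)

/-- Breadth-first search takes polynomial time if the points that can be reached (or those with
some property `P` that is passed on to successors) are polynomially many and of polynomial size. -/
theorem bfs (hinj : ∀ g, Function.Injective (eb g))
    {x : ∀ g, β g} {succ : ∀ g, β g → List (β g)} (hx : ∀ g, P g (x g))
    (hP : ∀ g b, P g b → ∀ c ∈ succ g b, P g c) (hfin : ∀ g, {b | P g b}.Finite)
    (hcard : PolyBdd e fun g => {b | P g b}.ncard)
    (hsize : ∃ B, PolyBdd e B ∧ ∀ g b, P g b → (eb g b).size ≤ B g)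
    (h0 : Comp e fun g => eb g (x g))
    (hs : Comp (extend e eb) fun p => Data.ofList ((succ p.1 p.2).map (eb p.1)))
    {N : Γ → ℕ} (hN : Comp e fun g => Data.ofNat (N g)) :
    Comp e fun g => Data.ofList ((WhileTree.bfs (succ g) (x g) (N g)).map (eb g)) := by
  obtain ⟨B, hB, hsB⟩ := hsize
  have hLB : ∀ g (L : List (β g)), L.Nodup → (∀ b ∈ L, P g b) →
      (Data.ofList (L.map (eb g))).size ≤ {b | P g b}.ncard * (B g + 1) + 1 := by
    intro g L hLn hLP
    refine (Data.size_ofList_le (b := B g) fun d hd => ?_).trans ?_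
    · obtain ⟨b, hb, rfl⟩ := List.mem_map.1 hd
      exact hsB g b (hLP b hb)
    · have h2 : ((L.toFinset : Finset (β g)) : Set (β g)) ⊆ {b | P g b} := fun b hb =>
        hLP b (by simpa using hb)
      have h3 := Set.ncard_le_ncard h2 (hfin g)
      rw [Set.ncard_coe_finset, List.toFinset_card_of_nodup hLn] at h3
      rw [List.length_map]
      exact Nat.add_le_add_right (Nat.mul_le_mul_right _ h3) 1
  have hBB : PolyBdd e fun g => {b | P g b}.ncard * (B g + 1) + 1 :=
    (hcard.mul (hB.add (PolyBdd.const 1))).add (PolyBdd.const 1)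
  refine (fold (fun g => List.replicate (N g) Data.nil)
    (fun g i => Data.ofList ((WhileTree.bfs (succ g) (x g) i).map (eb g))) hN h0.singleton ?_
    ⟨_, hBB, fun g i _ => hLB g _ (nodup_bfs _ _ _) (forall_mem_bfs (hx g) (hP g))⟩).of_eq
    fun g => by simp
  let E : (Σ g, Fin (List.replicate (N g) Data.nil).length) → Data := fun p =>
      Data.cons (e p.1) (Data.cons ((List.replicate (N p.1) Data.nil).get p.2)
        (Data.ofList ((WhileTree.bfs (succ p.1) (x p.1) p.2).map (eb p.1))))
  have hacc : Comp E fun p =>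
      Data.ofList ((WhileTree.bfs (succ p.1) (x p.1) p.2).map (eb p.1)) := Comp.id.tail.tail
  have hs' : Comp (extend E (β := fun p => β p.1) fun p => eb p.1)
      fun p => Data.ofList ((succ p.1.1 p.2).map (eb p.1.1)) := by
    have h1 := hs.reindex (Δ := Σ p : (Σ g, Fin (List.replicate (N g) Data.nil).length), β p.1)
      fun p => ⟨p.1.1, p.2⟩
    exact ((Comp.id (e := extend E (β := fun p => β p.1) fun p => eb p.1)).head.head.pair
      Comp.id.tail).comp h1
  have hfl := flatMap (Γ := Σ g, Fin (List.replicate (N g) Data.nil).length)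
    (β := fun p => β p.1) (eb := fun p => eb p.1) hacc
    (F := fun p b => (succ p.1 b).map (eb p.1)) hs'
  refine insertAll (Γ := Σ g, Fin (List.replicate (N g) Data.nil).length)
    (β := fun p => β p.1) (eb := fun p => eb p.1) (P := fun p => P p.1)
    (fun p => hinj p.1) ⟨fun p => {b | P p.1 b}.ncard * (B p.1 + 1) + 1, ?_, fun p => hLB p.1⟩
    hacc (hfl.of_eq fun p => by rw [List.map_flatMap]) (fun p => nodup_bfs _ _ _)
    (fun p => forall_mem_bfs (hx p.1) (hP p.1)) fun p b hb => ?_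
  · obtain ⟨q, hq⟩ := hBB
    refine ⟨q, fun p => (hq p.1).trans (polyEval_mono q ?_)⟩
    simp only [Data.size]
    omega
  · obtain ⟨a, ha, hb⟩ := List.mem_flatMap.1 hb
    exact hP p.1 a (forall_mem_bfs (hx p.1) (hP p.1) a ha) b hb

end Comp

end WhileTree

namespace HTN

open WhileTree

/-! ### Executions of a primitive network -/

/-- The primitive instances with at most `k` reachable states and generalized width at most `w`. -/
abbrev BoundedInstance (k w : ℕ) : Type := {I : Instance // Bounded k w I}

namespace Domain

/-- The state after the execution of an action. -/
def next (D : Domain) (a : Fin D.nA) (s : D.State) : D.State := (s \ D.del a) ∪ D.add a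

theorem run_append (D : Domain) (s : D.State) (p q : List (Fin D.nA)) :
    D.run s (p ++ q) = (D.run s p).bind fun s' => D.run s' q := by
  induction p generalizing s with
  | nil => rfl
  | cons a p ih =>
    simp only [List.cons_append, run]
    split_ifs
    · exact ih _
    · rfl

theorem run_append_singleton_eq_some {D : Domain} {s s' : D.State} {p : List (Fin D.nA)}
    {a : Fin D.nA} : D.run s (p ++ [a]) = some s' ↔
      ∃ s₁, D.run s p = some s₁ ∧ D.pre a ⊆ s₁ ∧ s' = D.next a s₁ := by
  rw [run_append, Option.bind_eq_some_iff]
  refine exists_congr fun s₁ => and_congr_right fun _ => ?_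
  simp only [run, next]
  split_ifs with h <;> simp [h, eq_comm]

theorem next_mem_reachableStates {D : Domain} {s₀ s : D.State} (hs : s ∈ D.reachableStates s₀)
    {a : Fin D.nA} (ha : D.pre a ⊆ s) : D.next a s ∈ D.reachableStates s₀ := by
  obtain ⟨p, hp⟩ := hs
  exact ⟨p ++ [a], run_append_singleton_eq_some.2 ⟨s, hp, ha, rfl⟩⟩

theorem Decomposes.eq_of_isPrimitive {D : Domain} {tn tn' : D.Network} (h : Decomposes tn tn')
    (htn : IsPrimitive tn) : tn' = tn := by
  rcases Relation.ReflTransGen.cases_head h with h | ⟨_, ⟨t, c, m, hc, -⟩, -⟩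
  · exact h.symm
  · obtain ⟨a, ha⟩ := htn t
    rw [ha] at hc
    cases hc

end Domain

namespace BoundedInstance

variable {k w : ℕ} (I : BoundedInstance k w)

/-- The tasks of the network. -/
abbrev Task : Type := Fin I.1.tn.size

/-- The states of the domain. -/
abbrev State : Type := I.1.D.State

/-- The states of the state transition graph. -/
abbrev Reachable : Set I.State := I.1.D.reachableStates I.1.s₀

/-- The action of a task; all tasks are primitive. -/
noncomputable def act (t : I.Task) : Fin I.1.D.nA := (I.2.1 t).choose

theorem name_eq (t : I.Task) : I.1.tn.name t = Sum.inl (I.act t) := (I.2.1 t).choose_spec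

theorem initial_mem : I.1.s₀ ∈ I.Reachable := ⟨[], rfl⟩

/-- `I.Reaches s U`: the tasks in `U` can be executed in some order that respects the precedence
relation of the network, without tasks outside `U`, and this yields the state `s`. -/
inductive Reaches : I.State → Finset I.Task → Prop
  | initial : Reaches I.1.s₀ ∅
  | step {s : I.State} {U : Finset I.Task} {t : I.Task} : Reaches s U → t ∉ U →
      (∀ x, I.1.tn.prec x t = true → x ∈ U) → I.1.D.pre (I.act t) ⊆ s →
      Reaches (I.1.D.next (I.act t) s) (insert t U)

variable {I}

theorem Reaches.mem_reachable {s : I.State} {U : Finset I.Task} (h : I.Reaches s U) :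
    s ∈ I.Reachable := by
  induction h with
  | initial => exact I.initial_mem
  | step _ _ _ hpre ih => exact Domain.next_mem_reachableStates ih hpre

theorem Reaches.exists_list {s : I.State} {U : Finset I.Task} (h : I.Reaches s U) :
    ∃ l : List I.Task, l.Nodup ∧ l.toFinset = U ∧ I.1.D.run I.1.s₀ (l.map I.act) = some s ∧
      l.Pairwise (fun x y => I.1.tn.prec y x = false) ∧
      ∀ t ∈ l, ∀ x, I.1.tn.prec x t = true → x ∈ l := by
  induction h with
  | initial => exact ⟨[], by simp [Domain.run]⟩
  | @step s U t _ htU hpred hpre ih =>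
    obtain ⟨l, hnd, rfl, hrun, hpw, hdown⟩ := ih
    simp only [List.mem_toFinset] at htU hpred
    refine ⟨l ++ [t], ?_, ?_, ?_, ?_, ?_⟩
    · rw [List.nodup_append]
      exact ⟨hnd, by simp, by rintro a ha b hb rfl; simp at hb; exact htU (hb ▸ ha)⟩
    · ext; simp
    · rw [List.map_append]
      exact Domain.run_append_singleton_eq_some.2 ⟨s, hrun, hpre, rfl⟩
    · rw [List.pairwise_append]
      refine ⟨hpw, by simp, fun x hx y hy => ?_⟩
      rw [List.mem_singleton] at hy
      subst hy
      by_contra hc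
      exact htU (hdown x hx y (by simpa using hc))
    · intro y hy x hxy
      rcases List.mem_append.1 hy with hy | hy
      · exact List.mem_append_left _ (hdown y hy x hxy)
      · rw [List.mem_singleton] at hy
        subst hy
        exact List.mem_append_left _ (hpred x hxy)

theorem reaches_of_list {l : List I.Task} {s : I.State} (hnd : l.Nodup)
    (hrun : I.1.D.run I.1.s₀ (l.map I.act) = some s)
    (hpw : l.Pairwise (fun x y => I.1.tn.prec y x = false))
    (hdown : ∀ t ∈ l, ∀ x, I.1.tn.prec x t = true → x ∈ l) : I.Reaches s l.toFinset := by
  induction l using List.reverseRecOn generalizing s with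
  | nil =>
    simp only [List.map_nil, Domain.run, Option.some.injEq] at hrun
    subst hrun
    exact Reaches.initial
  | append_singleton l t ih =>
    rw [List.map_append] at hrun
    obtain ⟨s₁, hrun₁, hpre, rfl⟩ := Domain.run_append_singleton_eq_some.1 hrun
    rw [List.nodup_append] at hnd
    rw [List.pairwise_append] at hpw
    have ht : t ∉ l := fun h => hnd.2.2 t h t (by simp) rfl
    have h1 : I.Reaches s₁ l.toFinset := by
      refine ih hnd.1 hrun₁ hpw.1 fun y hy x hxy => ?_
      rcases List.mem_append.1 (hdown y (List.mem_append_left _ hy) x hxy) with h | h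
      · exact h
      · rw [List.mem_singleton] at h
        subst h
        have := hpw.2.2 y hy x (by simp)
        simp [hxy] at this
    have h2 : (l ++ [t]).toFinset = insert t l.toFinset := by ext; simp
    rw [h2]
    refine h1.step (by simpa using ht) (fun x hx => ?_) hpre
    rcases List.mem_append.1 (hdown t (by simp) x hx) with h | h
    · simpa using h
    · rw [List.mem_singleton] at h
      subst h
      simp [I.1.tn.prec_irrefl] at hx

/-- An executed set of tasks gives a solution, namely the restriction of the network to this
set. -/
theorem Reaches.exists_part {s : I.State} {U : Finset I.Task} (h : I.Reaches s U) :
    ∃ (sol : I.1.D.Network) (l : List (Fin sol.size)) (p : List (Fin I.1.D.nA))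
      (ι : Fin sol.size → I.Task), Domain.IsPrimitive sol ∧ Domain.Executes I.1.s₀ sol l p s ∧
      Domain.IsPartVia sol I.1.tn ι ∧ (∀ t, t ∈ U ↔ ∃ i, ι i = t) ∧
      (p : Multiset (Fin I.1.D.nA)) = U.val.map I.act := by
  obtain ⟨l, hnd, rfl, hrun, hpw, hdown⟩ := h.exists_list
  refine ⟨⟨l.length, fun i j => I.1.tn.prec (l.get i) (l.get j), fun _ => I.1.tn.prec_irrefl _,
    fun _ _ _ => I.1.tn.prec_trans _ _ _, fun i => I.1.tn.name (l.get i)⟩,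
    List.finRange l.length, l.map I.act, l.get, fun i => ⟨_, I.name_eq _⟩,
    ⟨⟨List.nodup_finRange _, List.mem_finRange, ?_⟩, ?_, hrun⟩,
    ⟨List.nodup_iff_injective_get.1 hnd, fun x t' hx => ?_, fun _ => rfl⟩, fun t => ?_, ?_⟩
  · have hl : (List.finRange l.length).map l.get = l := by simp
    rw [← hl, List.pairwise_map] at hpw
    exact hpw
  · have hl : (List.finRange l.length).map l.get = l := by simp
    conv_rhs => rw [← hl]
    simp only [List.map_map]
    exact List.map_congr_left fun i _ => I.name_eq _
  · obtain ⟨i, rfl⟩ := List.mem_iff_get.1 (hdown _ (l.get_mem t') x hx)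
    exact ⟨i, rfl, hx⟩
  · rw [List.mem_toFinset, List.mem_iff_get]
  · rw [List.toFinset_val, List.dedup_eq_self.2 hnd]
    rfl

/-- The tasks of a part of the network with an executable linearization form an executed set. -/
theorem reaches_of_isPartVia {sol : I.1.D.Network} {ι : Fin sol.size → I.Task}
    (hι : Domain.IsPartVia sol I.1.tn ι) {l : List (Fin sol.size)} {p : List (Fin I.1.D.nA)}
    {s : I.State} (hl : Domain.Executes I.1.s₀ sol l p s) :
    ∃ U, I.Reaches s U ∧ (∀ t, t ∈ U ↔ ∃ i, ι i = t) ∧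
      (p : Multiset (Fin I.1.D.nA)) = U.val.map I.act := by
  obtain ⟨hinj, hprec, hname⟩ := hι
  obtain ⟨⟨hnd, hall, hpw⟩, hp, hrun⟩ := hl
  have hp' : p = (l.map ι).map I.act := by
    refine List.map_injective_iff.2 (Sum.inl_injective (β := Fin I.1.D.nC)) ?_
    rw [← hp, List.map_map, List.map_map]
    exact List.map_congr_left fun i _ => by rw [hname, I.name_eq]; rfl
  subst hp'
  have hnd' : (l.map ι).Nodup := hnd.map hinj
  refine ⟨(l.map ι).toFinset, reaches_of_list hnd' hrun ?_ ?_, fun t => by simp [hall], ?_⟩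
  · rw [List.pairwise_map]
    refine hpw.imp fun {i j} hij => ?_
    by_contra hc
    obtain ⟨t, ht, ht'⟩ := hprec (ι j) i (by simpa using hc)
    rw [hinj ht, hij] at ht'
    cases ht'
  · intro t ht x hx
    obtain ⟨i, -, rfl⟩ := List.mem_map.1 ht
    obtain ⟨j, rfl, -⟩ := hprec x i hx
    exact List.mem_map_of_mem (hall j)
  · rw [List.toFinset_val, List.dedup_eq_self.2 hnd']
    rfl

theorem planExistence_iff : PlanExistence I.1 ↔ ∃ s, I.Reaches s Finset.univ := by
  constructor
  · rintro ⟨sol, -, ⟨l, p, s, hl⟩, whole, hdec, -, ι, hι, hsurj⟩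
    obtain rfl := hdec.eq_of_isPrimitive I.2.1
    obtain ⟨U, hU, hUι, -⟩ := reaches_of_isPartVia hι hl
    have : U = Finset.univ := Finset.eq_univ_iff_forall.2 fun t => (hUι t).2 (hsurj t)
    exact ⟨s, this ▸ hU⟩
  · rintro ⟨s, hs⟩
    obtain ⟨sol, l, p, ι, hprim, hl, hι, hU, -⟩ := hs.exists_part
    exact ⟨sol, hprim, ⟨l, p, s, hl⟩, I.1.tn, Relation.ReflTransGen.refl, I.2.1, ι, hι,
      fun t => (hU t).1 (Finset.mem_univ t)⟩

/-- What can be demanded of the yielded state and of the multiset of executed actions of some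
solution can be demanded of an executed set of tasks: the network decomposes only into itself. -/
theorem exists_solution_iff (Q : I.State → Multiset (Fin I.1.D.nA) → Prop) :
    (∃ sol : I.1.D.Network, Domain.IsSolution I.1.tn I.1.s₀ sol ∧
      ∃ l p s, Domain.Executes I.1.s₀ sol l p s ∧ Q s p) ↔
      ∃ s U, I.Reaches s U ∧ Q s (U.val.map I.act) := by
  constructor
  · rintro ⟨sol, ⟨-, -, whole, hdec, -, ι, hι⟩, l, p, s, hl, hQ⟩
    obtain rfl := hdec.eq_of_isPrimitive I.2.1
    obtain ⟨U, hU, -, hp⟩ := reaches_of_isPartVia hι hl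
    exact ⟨s, U, hU, hp ▸ hQ⟩
  · rintro ⟨s, U, hU, hQ⟩
    obtain ⟨sol, l, p, ι, hprim, hl, hι, -, hp⟩ := hU.exists_part
    exact ⟨sol, ⟨hprim, ⟨l, p, s, hl⟩, I.1.tn, Relation.ReflTransGen.refl, I.2.1, ι, hι⟩,
      l, p, s, hl, hp ▸ hQ⟩

/-! ### Interchangeable isolated tasks -/

open scoped Classical in
/-- The effect of an action on the reachable states, as a partial function. -/
noncomputable def effect (I : BoundedInstance k w) (a : Fin I.1.D.nA) :
    I.Reachable → Option I.Reachable := fun s =>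
  if h : I.1.D.pre a ⊆ s.1 then
    some ⟨I.1.D.next a s.1, Domain.next_mem_reachableStates s.2 h⟩ else none

theorem effect_eq_iff {a b : Fin I.1.D.nA} : I.effect a = I.effect b ↔ ∀ s ∈ I.Reachable,
    (I.1.D.pre a ⊆ s ↔ I.1.D.pre b ⊆ s) ∧
      (I.1.D.pre a ⊆ s → I.1.D.next a s = I.1.D.next b s) := by
  rw [funext_iff, Subtype.forall]
  refine forall₂_congr fun s hs => ?_
  simp only [effect]
  split_ifs with h1 h2 h2 <;> simp [h1, h2]

/-- The kind of a task: the effect of its action. -/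
noncomputable abbrev kind (I : BoundedInstance k w) (t : I.Task) :
    I.Reachable → Option I.Reachable := I.effect (I.act t)

/-- The isolated tasks. -/
abbrev Isolated (I : BoundedInstance k w) (t : I.Task) : Prop := I.1.tn.IsIsolated t

theorem not_isolated_of_prec {x t : I.Task} (h : I.1.tn.prec x t = true) :
    ¬ I.Isolated x ∧ ¬ I.Isolated t :=
  ⟨fun hx => by simp [(hx t).1] at h, fun ht => by simp [(ht x).2] at h⟩

open scoped Classical in
/-- The isolated tasks of kind `τ` in a set. -/
noncomputable def isolatedOf (U : Finset I.Task) (τ : I.Reachable → Option I.Reachable) :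
    Finset I.Task := U.filter fun t => I.Isolated t ∧ I.kind t = τ

theorem mem_isolatedOf {U : Finset I.Task} {τ : I.Reachable → Option I.Reachable} {t : I.Task} :
    t ∈ isolatedOf U τ ↔ t ∈ U ∧ I.Isolated t ∧ I.kind t = τ := by
  simp [isolatedOf]

theorem isolatedOf_insert_of_not {U : Finset I.Task} {τ : I.Reachable → Option I.Reachable}
    {t : I.Task} (h : ¬ (I.Isolated t ∧ I.kind t = τ)) :
    isolatedOf (insert t U) τ = isolatedOf U τ := by
  ext x
  simp only [mem_isolatedOf, Finset.mem_insert]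
  constructor
  · rintro ⟨rfl | hx, hx'⟩
    · exact absurd hx' h
    · exact ⟨hx, hx'⟩
  · exact fun hx => ⟨Or.inr hx.1, hx.2⟩

theorem card_isolatedOf_insert {U : Finset I.Task} {t : I.Task} (htU : t ∉ U)
    (ht : I.Isolated t) :
    (isolatedOf (insert t U) (I.kind t)).card = (isolatedOf U (I.kind t)).card + 1 := by
  have : isolatedOf (insert t U) (I.kind t) = insert t (isolatedOf U (I.kind t)) := by
    ext x
    simp only [mem_isolatedOf, Finset.mem_insert]
    constructor
    · rintro ⟨rfl | hx, hx'⟩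
      · exact Or.inl rfl
      · exact Or.inr ⟨hx, hx'⟩
    · rintro (rfl | hx)
      · exact ⟨Or.inl rfl, ht, rfl⟩
      · exact ⟨Or.inr hx.1, hx.2⟩
  rw [this, Finset.card_insert_of_notMem fun h => htU (mem_isolatedOf.1 h).1]

/-- Two sets of tasks are similar if they have the same nonisolated tasks and equally many isolated
tasks of each kind. -/
def Similar (U V : Finset I.Task) : Prop :=
  (∀ t, ¬ I.Isolated t → (t ∈ U ↔ t ∈ V)) ∧
    ∀ τ, (isolatedOf U τ).card = (isolatedOf V τ).card

theorem Similar.insert_of_not_isolated {U V : Finset I.Task} (h : Similar U V) {t : I.Task}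
    (ht : ¬ I.Isolated t) : Similar (insert t U) (insert t V) :=
  ⟨fun x hx => by simp [h.1 x hx], fun τ => by
    rw [isolatedOf_insert_of_not fun h => ht h.1, isolatedOf_insert_of_not fun h => ht h.1, h.2]⟩

theorem similar_insert_insert_iff {U V : Finset I.Task} {t t' : I.Task} (htU : t ∉ U)
    (htV : t' ∉ V) (ht : I.Isolated t) (ht' : I.Isolated t') (hk : I.kind t' = I.kind t) :
    Similar (insert t U) (insert t' V) ↔ Similar U V := by
  refine and_congr (forall₂_congr fun x hx => ?_) (forall_congr' fun τ => ?_)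
  · have h1 : x ≠ t := fun h => hx (h ▸ ht)
    have h2 : x ≠ t' := fun h => hx (h ▸ ht')
    simp [h1, h2]
  · by_cases hτ : I.kind t = τ
    · subst hτ
      have := card_isolatedOf_insert htV ht'
      rw [hk] at this
      rw [card_isolatedOf_insert htU ht, this, Nat.add_right_cancel_iff]
    · rw [isolatedOf_insert_of_not fun h => hτ h.2,
        isolatedOf_insert_of_not fun h => hτ (hk ▸ h.2)]

/-- In an execution, isolated tasks may be exchanged for others of the same kind. -/
theorem Reaches.of_similar {s : I.State} {U : Finset I.Task} (h : I.Reaches s U)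
    {V : Finset I.Task} (hV : Similar U V) : I.Reaches s V := by
  induction h generalizing V with
  | initial =>
    have : V = ∅ := by
      refine Finset.eq_empty_of_forall_notMem fun t ht => ?_
      by_cases hi : I.Isolated t
      · have h1 : t ∈ isolatedOf V (I.kind t) := mem_isolatedOf.2 ⟨ht, hi, rfl⟩
        have h2 := hV.2 (I.kind t)
        rw [show isolatedOf (∅ : Finset I.Task) (I.kind t) = ∅ by ext; simp [mem_isolatedOf],
          Finset.card_empty] at h2
        rw [Finset.card_eq_zero.1 h2.symm] at h1
        simp at h1
      · simpa using (hV.1 t hi).2 ht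
    exact this ▸ Reaches.initial
  | @step s U t hs htU hpred hpre ih =>
    by_cases hi : I.Isolated t
    · -- Remove from `V` some isolated task of the same kind as `t`.
      have h1 := card_isolatedOf_insert htU hi
      rw [hV.2] at h1
      obtain ⟨t', ht'⟩ := Finset.card_pos.1 (show 0 < (isolatedOf V (I.kind t)).card by omega)
      obtain ⟨htV, hi', hk⟩ := mem_isolatedOf.1 ht'
      rw [← Finset.insert_erase htV] at hV ⊢
      rw [similar_insert_insert_iff htU (Finset.notMem_erase _ _) hi hi' hk] at hV
      obtain ⟨hpre', hnext⟩ := effect_eq_iff.1 hk.symm s hs.mem_reachable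
      rw [hnext hpre]
      refine (ih hV).step (Finset.notMem_erase _ _) (fun x hx => ?_) (hpre'.1 hpre)
      exact absurd hi' (not_isolated_of_prec hx).2
    · have htV : t ∈ V := (hV.1 t hi).1 (Finset.mem_insert_self _ _)
      have hV' : Similar U (V.erase t) := by
        refine ⟨fun x hx => ?_, fun τ => ?_⟩
        · have h1 := hV.1 x hx
          by_cases hxt : x = t
          · subst hxt
            simpa using htU
          · simpa [hxt] using h1
        · have h1 := hV.2 τ
          rw [← Finset.insert_erase htV] at h1
          rwa [isolatedOf_insert_of_not fun h => hi h.1,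
            isolatedOf_insert_of_not fun h => hi h.1] at h1
      rw [← Finset.insert_erase htV]
      refine (ih hV').step (Finset.notMem_erase _ _) (fun x hx => ?_) hpre
      exact (hV'.1 x (not_isolated_of_prec hx).1).1 (hpred x hx)

/-! ### Search among the canonical configurations -/

/-- A configuration: a state and the set of the tasks that have been executed. -/
abbrev Config (I : BoundedInstance k w) : Type := I.State × Finset I.Task

/-- The search may execute the task `t` next. Among the isolated tasks of one kind, it uses
those with smaller index first. -/
def Allowed (c : I.Config) (t : I.Task) : Prop :=
  t ∉ c.2 ∧ (∀ x, I.1.tn.prec x t = true → x ∈ c.2) ∧ I.1.D.pre (I.act t) ⊆ c.1 ∧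
    (I.Isolated t → ∀ x, x < t → I.Isolated x → I.kind x = I.kind t → x ∈ c.2)

/-- The configuration after the execution of the task `t`. -/
noncomputable def after (c : I.Config) (t : I.Task) : I.Config :=
  (I.1.D.next (I.act t) c.1, insert t c.2)

open scoped Classical in
/-- The configurations that the search visits after `c`. -/
noncomputable def successors (I : BoundedInstance k w) (c : I.Config) : List I.Config :=
  ((List.finRange I.1.tn.size).filter (Allowed c)).map (after c)

theorem mem_successors {c d : I.Config} :
    d ∈ I.successors c ↔ ∃ t, Allowed c t ∧ after c t = d := by
  simp [successors]

/-- All configurations that the search visits. -/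
noncomputable def configs (I : BoundedInstance k w) : List I.Config :=
  bfs I.successors (I.1.s₀, ∅) I.1.tn.size

/-- Configurations with a reachable state and a set of tasks that is closed under predecessors and
contains, of each kind of isolated tasks, an initial segment. -/
def Canonical (c : I.Config) : Prop :=
  c.1 ∈ I.Reachable ∧ (∀ x t, I.1.tn.prec x t = true → t ∈ c.2 → x ∈ c.2) ∧
    ∀ t ∈ c.2, I.Isolated t → ∀ x, x < t → I.Isolated x → I.kind x = I.kind t → x ∈ c.2

theorem canonical_initial : Canonical ((I.1.s₀, ∅) : I.Config) :=
  ⟨I.initial_mem, by simp, by simp⟩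

theorem Canonical.of_mem_successors {c : I.Config} (hc : Canonical c) {d : I.Config}
    (hd : d ∈ I.successors c) : Canonical d := by
  obtain ⟨t, ⟨-, hpred, hpre, hiso⟩, rfl⟩ := mem_successors.1 hd
  refine ⟨Domain.next_mem_reachableStates hc.1 hpre, fun x y hxy hy => ?_,
    fun y hy hiy x hxy hix hk => ?_⟩
  · rcases Finset.mem_insert.1 hy with rfl | hy
    · exact Finset.mem_insert_of_mem (hpred x hxy)
    · exact Finset.mem_insert_of_mem (hc.2.1 x y hxy hy)
  · rcases Finset.mem_insert.1 hy with rfl | hy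
    · exact Finset.mem_insert_of_mem (hiso hiy x hxy hix hk)
    · exact Finset.mem_insert_of_mem (hc.2.2 y hy hiy x hxy hix hk)

theorem reaches_of_mem_configs {c : I.Config} (hc : c ∈ I.configs) : I.Reaches c.1 c.2 := by
  refine forall_mem_bfs (P := fun c : I.Config => I.Reaches c.1 c.2) Reaches.initial
    (fun c hc d hd => ?_) c hc
  obtain ⟨t, ⟨htU, hpred, hpre, -⟩, rfl⟩ := mem_successors.1 hd
  exact hc.step htU hpred hpre

/-- The search visits every execution up to the choice among isolated tasks of the same kind. -/
theorem Reaches.exists_mem_configs {s : I.State} {V : Finset I.Task} (h : I.Reaches s V) :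
    ∃ U, (s, U) ∈ I.configs ∧ Similar U V := by
  suffices H : ∃ U, (s, U) ∈ bfs I.successors (I.1.s₀, ∅) V.card ∧ Similar U V by
    obtain ⟨U, hU, hUV⟩ := H
    exact ⟨U, bfs_mono (by simpa using V.card_le_univ) hU, hUV⟩
  induction h with
  | initial => exact ⟨∅, by simp [bfs], fun _ _ => Iff.rfl, fun _ => rfl⟩
  | @step s V t hs htV hpred hpre ih =>
    obtain ⟨U, hU, hUV⟩ := ih
    rw [Finset.card_insert_of_notMem htV]
    by_cases hi : I.Isolated t
    · -- Not all isolated tasks of the kind of `t` are in `U`; take the first one that is not.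
      have hex : ∃ x, I.Isolated x ∧ I.kind x = I.kind t ∧ x ∉ U := by
        by_contra! hc
        have h1 : insert t (isolatedOf V (I.kind t)) ⊆ isolatedOf Finset.univ (I.kind t) := by
          intro x hx
          rcases Finset.mem_insert.1 hx with rfl | hx
          · exact mem_isolatedOf.2 ⟨Finset.mem_univ _, hi, rfl⟩
          · exact mem_isolatedOf.2 ⟨Finset.mem_univ _, (mem_isolatedOf.1 hx).2⟩
        have h2 : isolatedOf Finset.univ (I.kind t) ⊆ isolatedOf U (I.kind t) := fun x hx =>
          have h := (mem_isolatedOf.1 hx).2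
          mem_isolatedOf.2 ⟨hc x h.1 h.2, h⟩
        have h3 := Finset.card_le_card (h1.trans h2)
        rw [Finset.card_insert_of_notMem fun h => htV (mem_isolatedOf.1 h).1, hUV.2] at h3
        omega
      obtain ⟨x, ⟨hix, hkx, hxU⟩, hmin⟩ := WellFounded.has_min
        (wellFounded_lt (α := I.Task)) {x | I.Isolated x ∧ I.kind x = I.kind t ∧ x ∉ U} hex
      obtain ⟨hpre', hnext⟩ := effect_eq_iff.1 hkx.symm s hs.mem_reachable
      refine ⟨insert x U, mem_bfs_succ hU (mem_successors.2 ⟨x, ⟨hxU, fun y hy => ?_,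
        hpre'.1 hpre, fun _ y hyx hiy hk => ?_⟩, ?_⟩), ?_⟩
      · exact absurd hix (not_isolated_of_prec hy).2
      · by_contra hyU
        exact hmin y ⟨hiy, hk.trans hkx, hyU⟩ hyx
      · rw [after, hnext hpre]
      · rwa [similar_insert_insert_iff hxU htV hix hi hkx.symm]
    · refine ⟨insert t U, mem_bfs_succ hU (mem_successors.2 ⟨t, ⟨?_, fun x hx => ?_, hpre,
        fun h => absurd h hi⟩, rfl⟩), hUV.insert_of_not_isolated hi⟩
      · exact fun h => htV ((hUV.1 t hi).1 h)
      · exact (hUV.1 x (not_isolated_of_prec hx).1).2 (hpred x hx)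

/-! ### The number of canonical configurations -/

open scoped Classical in
/-- The maximal nonisolated tasks of a set. -/
noncomputable def tops (U : Finset I.Task) : Finset I.Task :=
  U.filter fun t => ¬ I.Isolated t ∧ ∀ x ∈ U, I.1.tn.prec t x = false

theorem mem_tops {U : Finset I.Task} {t : I.Task} :
    t ∈ tops U ↔ t ∈ U ∧ ¬ I.Isolated t ∧ ∀ x ∈ U, I.1.tn.prec t x = false := by
  simp [tops]

theorem card_tops_le (U : Finset I.Task) : (tops U).card ≤ w := by
  classical
  refine le_trans ?_ I.2.2.2
  refine Finset.le_sup (f := Finset.card) (Finset.mem_filter.2 ⟨Finset.mem_univ _,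
    fun t ht => (mem_tops.1 ht).2.1, fun x hx y hy _ hxy => ?_⟩)
  have := (mem_tops.1 hx).2.2 y (mem_tops.1 hy).1
  simp [hxy] at this

theorem exists_mem_tops {U : Finset I.Task} {t : I.Task} (ht : t ∈ U) (hi : ¬ I.Isolated t) :
    ∃ m ∈ tops U, t = m ∨ I.1.tn.prec t m = true := by
  classical
  -- Among the tasks of `U` from `t` upwards, one with the most predecessors is maximal.
  obtain ⟨m, hm, hmax⟩ := Finset.exists_max_image
    (U.filter fun m => t = m ∨ I.1.tn.prec t m = true)
    (fun m => (Finset.univ.filter fun x => I.1.tn.prec x m = true).card)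
    ⟨t, by simp [ht]⟩
  simp only [Finset.mem_filter] at hm hmax
  refine ⟨m, mem_tops.2 ⟨hm.1, ?_, fun x hx => ?_⟩, hm.2⟩
  · rcases hm.2 with rfl | h
    · exact hi
    · exact (not_isolated_of_prec h).2
  · by_contra hmx
    rw [Bool.not_eq_false] at hmx
    refine absurd (hmax x ⟨hx, Or.inr ?_⟩) (not_le.2 (Finset.card_lt_card ?_))
    · rcases hm.2 with rfl | h
      · exact hmx
      · exact I.1.tn.prec_trans _ _ _ h hmx
    · refine Finset.ssubset_iff.2 ⟨m, by simp [I.1.tn.prec_irrefl], fun y hy => ?_⟩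
      rcases Finset.mem_insert.1 hy with rfl | hy
      · simpa using hmx
      · simp only [Finset.mem_filter, Finset.mem_univ, true_and] at hy ⊢
        exact I.1.tn.prec_trans _ _ _ hy hmx

/-- Of two initial segments of a linear order, the one with fewer elements is contained in the
other. This applies to the isolated tasks of each kind; the nonisolated ones lie below `tops`. -/
theorem Canonical.subset {c d : I.Config} (hc : Canonical c) (hd : Canonical d)
    (htops : tops c.2 ⊆ tops d.2)
    (hcard : ∀ τ, (isolatedOf c.2 τ).card ≤ (isolatedOf d.2 τ).card) : c.2 ⊆ d.2 := by
  intro t ht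
  by_cases hi : I.Isolated t
  · by_contra htd
    refine absurd (hcard (I.kind t)) (not_le.2 (Finset.card_lt_card ?_))
    refine Finset.ssubset_iff.2 ⟨t, fun h => htd (mem_isolatedOf.1 h).1, fun x hx => ?_⟩
    rcases Finset.mem_insert.1 hx with rfl | hx
    · exact mem_isolatedOf.2 ⟨ht, hi, rfl⟩
    · obtain ⟨hxd, hix, hk⟩ := mem_isolatedOf.1 hx
      refine mem_isolatedOf.2 ⟨?_, hix, hk⟩
      rcases lt_trichotomy x t with h | rfl | h
      · exact hc.2.2 t ht hi x h hix hk
      · exact ht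
      · exact absurd (hd.2.2 x hxd hix t h hi hk.symm) htd
  · obtain ⟨m, hm, rfl | h⟩ := exists_mem_tops ht hi
    · exact (mem_tops.1 (htops hm)).1
    · exact hd.2.1 t m h (mem_tops.1 (htops hm)).1

/-- A finite set with at most `w` elements is the range of a partial function on `Fin w`. -/
theorem exists_enumeration {α : Type} (B : Finset α) (hB : B.card ≤ w) :
    ∃ f : Fin w → Option α, ∀ x, x ∈ B ↔ ∃ i, f i = some x := by
  refine ⟨fun i => B.toList[i.1]?, fun x => ?_⟩
  rw [← Finset.mem_toList, List.mem_iff_getElem?]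
  constructor
  · rintro ⟨i, hi⟩
    have hlt := (List.getElem?_eq_some_iff.1 hi).1
    rw [Finset.length_toList] at hlt
    exact ⟨⟨i, by omega⟩, hi⟩
  · rintro ⟨i, hi⟩
    exact ⟨i, hi⟩

theorem finite_canonical : {c : I.Config | Canonical c}.Finite := Set.toFinite _

/-- A canonical configuration is determined by its state, its maximal nonisolated tasks, which form
an antichain, and the numbers of its isolated tasks of each kind. -/
theorem ncard_canonical_le (I : BoundedInstance k w) : {c : I.Config | Canonical c}.ncard ≤
    k * ((I.1.tn.size + 1) ^ w * (I.1.tn.size + 1) ^ ((k + 1) ^ k)) := by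
  classical
  choose f hf using fun U : Finset I.Task => exists_enumeration (tops U) (card_tops_le U)
  let Φ : {c : I.Config | Canonical c} → I.Reachable × (Fin w → Option I.Task) ×
      ((I.Reachable → Option I.Reachable) → Fin (I.1.tn.size + 1)) := fun c =>
    (⟨c.1.1, c.2.1⟩, f c.1.2, fun τ => ⟨(isolatedOf c.1.2 τ).card,
      Nat.lt_succ_of_le (by simpa using (isolatedOf c.1.2 τ).card_le_univ)⟩)
  have hΦ : Function.Injective Φ := by
    rintro ⟨c, hc⟩ ⟨d, hd⟩ h
    simp only [Φ, Prod.mk.injEq, Subtype.mk.injEq, funext_iff, Fin.mk.injEq] at h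
    obtain ⟨h1, h2, h3⟩ := h
    have htops : tops c.2 = tops d.2 := by
      ext x
      rw [hf, hf]
      simp [h2]
    refine Subtype.ext (Prod.ext h1 (Finset.Subset.antisymm ?_ ?_))
    · exact Canonical.subset hc hd htops.subset fun τ => (h3 τ).le
    · exact Canonical.subset hd hc htops.symm.subset fun τ => (h3 τ).ge
  have hr : Nat.card I.Reachable ≤ k := I.2.2.1
  have hcard := Nat.card_le_card_of_injective Φ hΦ
  rw [Nat.card_coe_set_eq, Nat.card_prod, Nat.card_prod, Nat.card_fun, Nat.card_fun, Nat.card_fun,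
    Finite.card_option, Finite.card_option, Nat.card_fin, Nat.card_fin, Nat.card_fin] at hcard
  refine hcard.trans (Nat.mul_le_mul hr (Nat.mul_le_mul_left _ (Nat.pow_le_pow_right
    (Nat.succ_pos _) ?_)))
  exact (Nat.pow_le_pow_left (Nat.succ_le_succ hr) _).trans
    (Nat.pow_le_pow_right (Nat.succ_pos _) hr)

/-! ### Recognizing the answer from the canonical configurations -/

/-- A set similar to the set of all tasks is the set of all tasks. -/
theorem planExistence_iff_configs :
    PlanExistence I.1 ↔ ∃ c ∈ I.configs, ∀ t, t ∈ c.2 := by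
  rw [planExistence_iff]
  constructor
  · rintro ⟨s, hs⟩
    obtain ⟨U, hU, hsim⟩ := hs.exists_mem_configs
    refine ⟨_, hU, fun t => ?_⟩
    by_cases hi : I.Isolated t
    · have h1 : isolatedOf U (I.kind t) = isolatedOf Finset.univ (I.kind t) :=
        Finset.eq_of_subset_of_card_le (fun x hx =>
          mem_isolatedOf.2 ⟨Finset.mem_univ _, (mem_isolatedOf.1 hx).2⟩) (hsim.2 _).ge
      have h2 : t ∈ isolatedOf Finset.univ (I.kind t) :=
        mem_isolatedOf.2 ⟨Finset.mem_univ _, hi, rfl⟩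
      exact (mem_isolatedOf.1 (h1 ▸ h2)).1
    · exact (hsim.1 t hi).2 (Finset.mem_univ t)
  · rintro ⟨c, hc, h⟩
    refine ⟨c.1, ?_⟩
    rw [← Finset.eq_univ_iff_forall.2 h]
    exact reaches_of_mem_configs hc

theorem exists_reaches_iff_configs (Q : I.State → Prop) :
    (∃ s U, I.Reaches s U ∧ Q s) ↔ ∃ c ∈ I.configs, Q c.1 := by
  constructor
  · rintro ⟨s, V, hs, hQ⟩
    obtain ⟨U, hU, -⟩ := hs.exists_mem_configs
    exact ⟨_, hU, hQ⟩
  · rintro ⟨c, hc, hQ⟩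
    exact ⟨c.1, c.2, reaches_of_mem_configs hc, hQ⟩

open scoped Classical in
/-- The number of the nonisolated tasks in `U` with action `a`. -/
noncomputable def fixedCount (U : Finset I.Task) (a : Fin I.1.D.nA) : ℕ :=
  (Finset.univ.filter fun t => t ∈ U ∧ ¬ I.Isolated t ∧ I.act t = a).card

open scoped Classical in
/-- The isolated tasks in `U` can be exchanged for others of the same kinds such that the
multiset `S` of actions is covered: there are enough tasks for each single action, and the
occurrences that the nonisolated tasks leave uncovered do not exceed, for any kind, the number of
isolated tasks of this kind in `U`. -/
def CoversUpToExchange (S : Multiset (Fin I.1.D.nA)) (U : Finset I.Task) : Prop :=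
  (∀ a, S.count a ≤ (Finset.univ.filter fun t => (I.Isolated t ∨ t ∈ U) ∧ I.act t = a).card) ∧
    ∀ b, (∑ a, if I.effect a = I.effect b then S.count a - fixedCount U a else 0) ≤
      (Finset.univ.filter fun t =>
        t ∈ U ∧ I.Isolated t ∧ I.effect (I.act t) = I.effect b).card

theorem Similar.fixedCount_eq {U V : Finset I.Task} (h : Similar U V) (a : Fin I.1.D.nA) :
    fixedCount U a = fixedCount V a := by
  classical
  refine congrArg Finset.card (Finset.filter_congr fun t _ => ?_)
  by_cases hi : I.Isolated t
  · simp [hi]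
  · simp [h.1 t hi]

open scoped Classical in
theorem le_map_act_iff {S : Multiset (Fin I.1.D.nA)} {U : Finset I.Task} :
    S ≤ U.val.map I.act ↔ ∀ a, S.count a ≤ (U.filter fun t => I.act t = a).card := by
  rw [Multiset.le_iff_count]
  refine forall_congr' fun a => ?_
  rw [Multiset.count_map, Finset.card_def, Finset.filter_val]
  simp only [eq_comm]

open scoped Classical in
theorem card_filter_act (U : Finset I.Task) (a : Fin I.1.D.nA) :
    (U.filter fun t => I.act t = a).card =
      fixedCount U a + (U.filter fun t => I.Isolated t ∧ I.act t = a).card := by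
  rw [fixedCount, ← Finset.card_union_of_disjoint]
  · congr 1
    ext t
    simp only [Finset.mem_filter, Finset.mem_union, Finset.mem_univ, true_and]
    by_cases hi : I.Isolated t <;> simp [hi]
  · refine Finset.disjoint_left.2 fun t h1 h2 => ?_
    simp only [Finset.mem_filter, Finset.mem_univ, true_and] at h1 h2
    exact h1.2.1 h2.2.1

open scoped Classical in
theorem card_isolatedOf_eq (U : Finset I.Task) (b : Fin I.1.D.nA) :
    (Finset.univ.filter fun t =>
      t ∈ U ∧ I.Isolated t ∧ I.effect (I.act t) = I.effect b).card =
      (isolatedOf U (I.effect b)).card := by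
  congr 1
  ext t
  simp [mem_isolatedOf]

/-- Isolated tasks of one kind cover occurrences of the actions of this kind only, so the condition
is necessary. -/
theorem CoversUpToExchange.of_similar {S : Multiset (Fin I.1.D.nA)} {U V : Finset I.Task}
    (h : Similar U V) (hS : S ≤ V.val.map I.act) : CoversUpToExchange S U := by
  classical
  rw [le_map_act_iff] at hS
  refine ⟨fun a => (hS a).trans (Finset.card_le_card fun t ht => ?_), fun b => ?_⟩
  · simp only [Finset.mem_filter, Finset.mem_univ, true_and] at ht ⊢
    by_cases hi : I.Isolated t
    · exact ⟨Or.inl hi, ht.2⟩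
    · exact ⟨Or.inr ((h.1 t hi).2 ht.1), ht.2⟩
  · rw [card_isolatedOf_eq, h.2, Finset.card_eq_sum_card_fiberwise (f := I.act)
      (t := Finset.univ) (fun _ _ => Finset.mem_coe.2 (Finset.mem_univ _))]
    refine Finset.sum_le_sum fun a _ => ?_
    split_ifs with hab
    · have h1 := hS a
      rw [card_filter_act, ← h.fixedCount_eq] at h1
      refine (show _ ≤ (V.filter fun t => I.Isolated t ∧ I.act t = a).card by omega).trans
        (Finset.card_le_card fun t ht => ?_)
      obtain ⟨htV, hi, rfl⟩ := Finset.mem_filter.1 ht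
      exact Finset.mem_filter.2 ⟨mem_isolatedOf.2 ⟨htV, hi, hab⟩, rfl⟩
    · exact Nat.zero_le _

theorem CoversUpToExchange.exists_similar {S : Multiset (Fin I.1.D.nA)} {U : Finset I.Task}
    (h : CoversUpToExchange S U) : ∃ V, Similar U V ∧ S ≤ V.val.map I.act := by
  classical
  obtain ⟨hA, hB⟩ := h
  -- For each action, choose isolated tasks for the occurrences that are left uncovered.
  have hR : ∀ a, ∃ R ⊆ Finset.univ.filter fun t => I.Isolated t ∧ I.act t = a,
      R.card = S.count a - fixedCount U a := by
    intro a
    refine Finset.exists_subset_card_eq ?_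
    have h1 := hA a
    have h2 : (Finset.univ.filter fun t => (I.Isolated t ∨ t ∈ U) ∧ I.act t = a) ⊆
        (Finset.univ.filter fun t => t ∈ U ∧ ¬ I.Isolated t ∧ I.act t = a) ∪
        Finset.univ.filter fun t => I.Isolated t ∧ I.act t = a := by
      intro t ht
      simp only [Finset.mem_filter, Finset.mem_univ, true_and, Finset.mem_union] at ht ⊢
      by_cases hi : I.Isolated t
      · exact Or.inr ⟨hi, ht.2⟩
      · exact Or.inl ⟨ht.1.resolve_left hi, hi, ht.2⟩
    have h3 := (Finset.card_le_card h2).trans (Finset.card_union_le _ _)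
    rw [← fixedCount] at h3
    omega
  choose R hRsub hRcard using hR
  have hRmem : ∀ {a t}, t ∈ R a → I.Isolated t ∧ I.act t = a := fun ht => by
    simpa using hRsub _ ht
  -- For each kind, extend the chosen tasks to as many tasks as `U` contains.
  have hW : ∀ τ, ∃ W, (Finset.univ.filter fun t => t ∈ R (I.act t) ∧ I.kind t = τ) ⊆ W ∧
      W ⊆ isolatedOf Finset.univ τ ∧ W.card = (isolatedOf U τ).card := by
    intro τ
    refine Finset.exists_subsuperset_card_eq (fun t ht => ?_) ?_
      (Finset.card_le_card fun t ht => mem_isolatedOf.2 ⟨Finset.mem_univ _,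
        (mem_isolatedOf.1 ht).2⟩)
    · simp only [Finset.mem_filter, Finset.mem_univ, true_and] at ht
      exact mem_isolatedOf.2 ⟨Finset.mem_univ _, (hRmem ht.1).1, ht.2⟩
    · by_cases hτ : ∃ b, I.effect b = τ
      · obtain ⟨b, rfl⟩ := hτ
        rw [← card_isolatedOf_eq]
        refine le_trans ?_ (hB b)
        rw [Finset.card_eq_sum_card_fiberwise (f := I.act) (t := Finset.univ)
          (fun _ _ => Finset.mem_coe.2 (Finset.mem_univ _))]
        refine Finset.sum_le_sum fun a _ => ?_
        split_ifs with hab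
        · rw [← hRcard]
          refine Finset.card_le_card fun t ht => ?_
          simp only [Finset.mem_filter, Finset.mem_univ, true_and] at ht
          exact ht.2 ▸ ht.1.1
        · rw [Nat.le_zero, Finset.card_eq_zero]
          refine Finset.eq_empty_of_forall_notMem fun t ht => hab ?_
          simp only [Finset.mem_filter, Finset.mem_univ, true_and] at ht
          rw [← ht.2]
          exact ht.1.2
      · rw [show (Finset.univ.filter fun t => t ∈ R (I.act t) ∧ I.kind t = τ) = ∅ from
          Finset.eq_empty_of_forall_notMem fun t ht => hτ ⟨I.act t, by
            simp only [Finset.mem_filter] at ht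
            exact ht.2.2⟩]
        simp
  choose W hRW hW hWcard using hW
  have hWmem : ∀ {τ t}, t ∈ W τ → I.Isolated t ∧ I.kind t = τ := fun ht =>
    (mem_isolatedOf.1 (hW _ ht)).2
  let V : Finset I.Task := Finset.univ.filter fun t =>
    (¬ I.Isolated t ∧ t ∈ U) ∨ t ∈ W (I.kind t)
  have hV : ∀ {t}, t ∈ V ↔ (¬ I.Isolated t ∧ t ∈ U) ∨ t ∈ W (I.kind t) := fun {t} => by
    simp [V]
  have hsim : Similar U V := by
    refine ⟨fun t hi => ?_, fun τ => ?_⟩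
    · rw [hV]
      exact ⟨fun ht => Or.inl ⟨hi, ht⟩, fun ht => ht.elim (fun h => h.2)
        fun h => absurd (hWmem h).1 hi⟩
    · rw [← hWcard]
      congr 1
      ext t
      rw [mem_isolatedOf, hV]
      constructor
      · exact fun ht => ⟨Or.inr ((hWmem ht).2 ▸ ht), hWmem ht⟩
      · rintro ⟨h | h, hi, rfl⟩
        · exact absurd hi h.1
        · exact h
  refine ⟨V, hsim, le_map_act_iff.2 fun a => ?_⟩
  rw [card_filter_act, ← hsim.fixedCount_eq]
  have h1 : R a ⊆ V.filter fun t => I.Isolated t ∧ I.act t = a := by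
    intro t ht
    obtain ⟨hi, rfl⟩ := hRmem ht
    exact Finset.mem_filter.2 ⟨hV.2 (Or.inr (hRW _ (by simpa using ht))), hi, rfl⟩
  have h2 := Finset.card_le_card h1
  have h3 := hRcard a
  omega

theorem exists_covering_iff_configs (S : Multiset (Fin I.1.D.nA)) :
    (∃ s U, I.Reaches s U ∧ S ≤ U.val.map I.act) ↔
      ∃ c ∈ I.configs, CoversUpToExchange S c.2 := by
  constructor
  · rintro ⟨s, V, hs, hS⟩
    obtain ⟨U, hU, hsim⟩ := hs.exists_mem_configs
    exact ⟨_, hU, CoversUpToExchange.of_similar hsim hS⟩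
  · rintro ⟨c, hc, h⟩
    obtain ⟨V, hsim, hS⟩ := h.exists_similar
    exact ⟨c.1, V, (reaches_of_mem_configs hc).of_similar hsim, hS⟩

end BoundedInstance

end HTN

/-! ### The algorithms -/

namespace WhileTree

theorem PolyTimeSolvableOn.of_decides {ι : Type} {enc : ι → Data} {C Yes : ι → Prop}
    (h : Decides (Γ := {i // C i}) (fun i => enc i.1) fun i => Yes i.1) :
    PolyTimeSolvableOn enc C Yes := by
  obtain ⟨f, ⟨c, m, q, -, H⟩, hf⟩ := h
  refine ⟨c, q, fun i hi => ?_⟩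
  obtain ⟨s', t, hexec, hs', -, ht, -⟩ := H ⟨i, hi⟩ (initStore (enc i)) rfl
  exact ⟨s', t, hexec, ht, hs' ▸ hf ⟨i, hi⟩⟩

end WhileTree

namespace HTN

open WhileTree

theorem encFun_injective {n : ℕ} {F : Fin n → Data} {G : Fin n → Data} (h : encFun F = encFun G) :
    F = G :=
  List.ofFn_injective (Data.ofList_injective h)

theorem encSet_injective {n : ℕ} : Function.Injective (encSet (n := n)) := by
  intro A B h
  ext i
  have := congrFun (encFun_injective h) i
  by_cases hA : i ∈ A <;> by_cases hB : i ∈ B <;> simp_all [Data.ofBool]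

theorem ofNat_val_injective {n : ℕ} : Function.Injective fun i : Fin n => Data.ofNat i := by
  intro i j h
  have := congrArg Data.size h
  simp only [Data.size_ofNat] at this
  exact Fin.ext (by omega)

theorem size_encSet_le {n : ℕ} (A : Finset (Fin n)) : (encSet A).size ≤ n * 4 + 1 := by
  refine (Data.size_ofList_le (b := 3) fun d hd => ?_).trans (by simp)
  obtain ⟨i, rfl⟩ := List.mem_ofFn.1 hd
  exact Data.size_ofBool_le _

section Sets

variable {Γ : Type} {e : Γ → Data} {n : Γ → ℕ} {A B : ∀ g, Finset (Fin (n g))}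
  {i j : ∀ g, Fin (n g)}

theorem decides_mem (hA : Comp e fun g => encSet (A g)) (hi : Comp e fun g => Data.ofNat (i g)) :
    Decides e fun g => i g ∈ A g :=
  (Decides.ofBool (Comp.get_ofFn hA hi)).congr fun g => by simp

theorem comp_encSet (hn : Comp e fun g => Data.ofNat (n g))
    (hA : Decides (extend e (encFin n)) fun x => x.2 ∈ A x.1) : Comp e fun g => encSet (A g) :=
  Comp.ofFn hn ((Comp.ite hA (Comp.nil.pair Comp.nil) Comp.nil).of_eq fun x => by
    split_ifs with h <;> simp [h, Data.ofBool])

theorem decides_subset (hn : Comp e fun g => Data.ofNat (n g)) (hA : Comp e fun g => encSet (A g))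
    (hB : Comp e fun g => encSet (B g)) : Decides e fun g => A g ⊆ B g :=
  Decides.forall_fin hn (p := fun g i => i ∈ A g → i ∈ B g)
    ((decides_mem hA.lift Comp.var).imp (decides_mem hB.lift Comp.var))

theorem comp_insert (hn : Comp e fun g => Data.ofNat (n g)) (hA : Comp e fun g => encSet (A g))
    (hi : Comp e fun g => Data.ofNat (i g)) : Comp e fun g => encSet (insert (i g) (A g)) :=
  comp_encSet hn (((Decides.eq_of_injective (fun _ => ofNat_val_injective) Comp.var hi.lift).or
    (decides_mem hA.lift Comp.var)).congr fun x => by rw [Finset.mem_insert])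

theorem decides_lt (hi : Comp e fun g => Data.ofNat (i g)) (hj : Comp e fun g => Data.ofNat (j g)) :
    Decides e fun g => i g < j g :=
  Decides.le (a := fun g => i g + 1) (Comp.nil.pair hi) hj

end Sets

namespace BoundedInstance

variable {k w : ℕ}

/-- The states of the state transition graph, in the order in which a search finds them. -/
def states (I : BoundedInstance k w) : List I.State :=
  bfs (fun s => ((List.finRange I.1.D.nA).filter fun a => I.1.D.pre a ⊆ s).map
    fun a => I.1.D.next a s) I.1.s₀ k

/-- There are at most `k` reachable states, so `k` rounds find all of them. -/
theorem mem_states {I : BoundedInstance k w} {s : I.State} : s ∈ I.states ↔ s ∈ I.Reachable := by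
  have hP : ∀ s ∈ I.Reachable, ∀ s' ∈ ((List.finRange I.1.D.nA).filter fun a =>
      I.1.D.pre a ⊆ s).map (fun a => I.1.D.next a s), s' ∈ I.Reachable := by
    intro s hs s' hs'
    simp only [List.mem_map, List.mem_filter, List.mem_finRange, true_and,
      decide_eq_true_eq] at hs'
    obtain ⟨a, ha, rfl⟩ := hs'
    exact Domain.next_mem_reachableStates hs ha
  constructor
  · exact forall_mem_bfs (P := fun s => s ∈ I.Reachable) I.initial_mem hP s
  · rintro ⟨p, hp⟩
    refine mem_bfs_of_ncard_le (P := fun s => s ∈ I.Reachable) I.initial_mem hP (Set.toFinite _)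
      I.2.2.1 ?_
    induction p using List.reverseRecOn generalizing s with
    | nil =>
      cases hp
      exact Relation.ReflTransGen.refl
    | append_singleton p a ih =>
      obtain ⟨s₁, h1, hpre, rfl⟩ := Domain.run_append_singleton_eq_some.1 hp
      refine (ih h1).tail ?_
      simp only [List.mem_map, List.mem_filter, List.mem_finRange, true_and, decide_eq_true_eq]
      exact ⟨a, hpre, rfl⟩

/-- The encoding of configurations. -/
def encConfig {I : BoundedInstance k w} (c : I.Config) : Data :=
  Data.cons (encSet c.1) (encSet c.2)

theorem encConfig_injective {I : BoundedInstance k w} :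
    Function.Injective (encConfig (I := I)) := by
  intro c d h
  simp only [encConfig, Data.cons.injEq] at h
  exact Prod.ext (encSet_injective h.1) (encSet_injective h.2)

variable {Γ : Type} {e : Γ → Data} {I : Γ → BoundedInstance k w}

theorem comp_nF (hI : Comp e fun g => encInstance (I g).1) :
    Comp e fun g => Data.ofNat (I g).1.D.nF := hI.head.head

theorem comp_nA (hI : Comp e fun g => encInstance (I g).1) :
    Comp e fun g => Data.ofNat (I g).1.D.nA := Comp.card_of_ofFn hI.head.tail.head

theorem comp_size (hI : Comp e fun g => encInstance (I g).1) :
    Comp e fun g => Data.ofNat (I g).1.tn.size := Comp.card_of_ofFn hI.tail.head.head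

theorem comp_initial (hI : Comp e fun g => encInstance (I g).1) :
    Comp e fun g => encSet (I g).1.s₀ := hI.tail.tail

theorem comp_act (hI : Comp e fun g => encInstance (I g).1) {t : ∀ g, (I g).Task}
    (ht : Comp e fun g => Data.ofNat (t g)) : Comp e fun g => Data.ofNat ((I g).act (t g)) :=
  (Comp.get_ofFn hI.tail.head.head ht).tail.of_eq fun g => by rw [name_eq]; rfl

theorem decides_prec (hI : Comp e fun g => encInstance (I g).1) {x t : ∀ g, (I g).Task}
    (hx : Comp e fun g => Data.ofNat (x g)) (ht : Comp e fun g => Data.ofNat (t g)) :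
    Decides e fun g => (I g).1.tn.prec (x g) (t g) = true :=
  Decides.ofBool (Comp.get_ofFn (F := fun g y => Data.ofBool ((I g).1.tn.prec (x g) y))
    (Comp.get_ofFn hI.tail.head.tail hx) ht)

theorem decides_isolated (hI : Comp e fun g => encInstance (I g).1) {t : ∀ g, (I g).Task}
    (ht : Comp e fun g => Data.ofNat (t g)) : Decides e fun g => (I g).Isolated (t g) :=
  (Decides.forall_fin (comp_size hI)
    (p := fun g x => ¬ (I g).1.tn.prec (t g) x = true ∧ ¬ (I g).1.tn.prec x (t g) = true)
    ((decides_prec hI.lift ht.lift Comp.var).not.and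
      (decides_prec hI.lift Comp.var ht.lift).not)).congr fun g => by
    simp [Isolated, TaskNetwork.IsIsolated]

theorem comp_action (hI : Comp e fun g => encInstance (I g).1) {a : ∀ g, Fin (I g).1.D.nA}
    (ha : Comp e fun g => Data.ofNat (a g)) : Comp e fun g =>
      Data.cons (encSet ((I g).1.D.pre (a g)))
        (Data.cons (encSet ((I g).1.D.del (a g))) (encSet ((I g).1.D.add (a g)))) :=
  Comp.get_ofFn (F := fun g a => Data.cons (encSet ((I g).1.D.pre a))
    (Data.cons (encSet ((I g).1.D.del a)) (encSet ((I g).1.D.add a)))) hI.head.tail.head ha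

theorem decides_pre_subset (hI : Comp e fun g => encInstance (I g).1)
    {a : ∀ g, Fin (I g).1.D.nA} (ha : Comp e fun g => Data.ofNat (a g)) {s : ∀ g, (I g).State}
    (hs : Comp e fun g => encSet (s g)) : Decides e fun g => (I g).1.D.pre (a g) ⊆ s g :=
  decides_subset (comp_nF hI) (comp_action hI ha).head hs

theorem comp_next (hI : Comp e fun g => encInstance (I g).1)
    {a : ∀ g, Fin (I g).1.D.nA} (ha : Comp e fun g => Data.ofNat (a g)) {s : ∀ g, (I g).State}
    (hs : Comp e fun g => encSet (s g)) : Comp e fun g => encSet ((I g).1.D.next (a g) (s g)) :=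
  have hdel : Comp e fun g => encSet ((I g).1.D.del (a g)) := (comp_action hI ha).tail.head
  have hadd : Comp e fun g => encSet ((I g).1.D.add (a g)) := (comp_action hI ha).tail.tail
  comp_encSet (comp_nF hI) ((((decides_mem hs.lift Comp.var).and
    (decides_mem hdel.lift Comp.var).not).or (decides_mem hadd.lift Comp.var)).congr fun x => by
      rw [Domain.next, Finset.mem_union, Finset.mem_sdiff])

theorem comp_states (hI : Comp e fun g => encInstance (I g).1) :
    Comp e fun g => Data.ofList ((I g).states.map encSet) := by
  have hs : Comp (extend e fun g (s : (I g).State) => encSet s) fun p => Data.ofList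
      ((((List.finRange (I p.1).1.D.nA).filter fun a => (I p.1).1.D.pre a ⊆ p.2).map
        fun a => (I p.1).1.D.next a p.2).map encSet) := by
    refine (Comp.map_filter (comp_nA (I := fun p : Σ g, (I g).State => I p.1) hI.lift).finRange
      (p := fun p a => (I p.1).1.D.pre a ⊆ p.2) (F := fun p a => encSet ((I p.1).1.D.next a p.2))
      ?_ ?_).of_eq fun p => by rw [List.map_map]; rfl
    · exact decides_pre_subset hI.lift.lift Comp.var Comp.var.lift
    · exact comp_next hI.lift.lift Comp.var Comp.var.lift
  refine Comp.bfs (P := fun g s => s ∈ (I g).Reachable) (fun _ => encSet_injective)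
    (fun g => (I g).initial_mem) (fun g s hs s' hs' => ?_) (fun g => Set.toFinite _)
    ((PolyBdd.const k).mono fun g => (I g).2.2.1)
    ⟨_, ((comp_nF hI).polyBdd.mul (PolyBdd.const 4)).add (PolyBdd.const 1),
      fun g s _ => (size_encSet_le s).trans ?_⟩ (comp_initial hI) hs (Comp.ofNat_const k)
  · simp only [List.mem_map, List.mem_filter, List.mem_finRange, true_and,
      decide_eq_true_eq] at hs'
    obtain ⟨a, ha, rfl⟩ := hs'
    exact Domain.next_mem_reachableStates hs ha
  · simp only [Data.size_ofNat]
    omega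

theorem decides_effect_eq (hI : Comp e fun g => encInstance (I g).1)
    {a b : ∀ g, Fin (I g).1.D.nA} (ha : Comp e fun g => Data.ofNat (a g))
    (hb : Comp e fun g => Data.ofNat (b g)) :
    Decides e fun g => (I g).effect (a g) = (I g).effect (b g) := by
  refine (Decides.forall_mem (comp_states hI) (p := fun g s =>
    ((I g).1.D.pre (a g) ⊆ s ↔ (I g).1.D.pre (b g) ⊆ s) ∧
      ((I g).1.D.pre (a g) ⊆ s → (I g).1.D.next (a g) s = (I g).1.D.next (b g) s)) ?_).congr
    fun g => by simp only [effect_eq_iff, mem_states]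
  have h1 := decides_pre_subset (I := fun p : Σ g, (I g).State => I p.1)
    (e := extend e fun _ => encSet) hI.lift ha.lift Comp.var
  have h2 := decides_pre_subset (I := fun p : Σ g, (I g).State => I p.1)
    (e := extend e fun _ => encSet) hI.lift hb.lift Comp.var
  exact (h1.iff h2).and (h1.imp (Decides.eq_of_injective (fun _ => encSet_injective)
    (comp_next hI.lift ha.lift Comp.var)
    (comp_next hI.lift hb.lift Comp.var)))

theorem decides_allowed (hI : Comp e fun g => encInstance (I g).1) {c : ∀ g, (I g).Config}
    (hc : Comp e fun g => encConfig (c g)) {t : ∀ g, (I g).Task}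
    (ht : Comp e fun g => Data.ofNat (t g)) : Decides e fun g => Allowed (c g) (t g) := by
  have hs : Comp e fun g => encSet (c g).1 := hc.head
  have hU : Comp e fun g => encSet (c g).2 := hc.tail
  refine (decides_mem hU ht).not.and (Decides.and ?_ (Decides.and
    (decides_pre_subset hI (comp_act hI ht) hs) ((decides_isolated hI ht).imp ?_)))
  · exact Decides.forall_fin (comp_size hI) ((decides_prec hI.lift Comp.var
      ht.lift).imp (decides_mem hU.lift Comp.var))
  · exact Decides.forall_fin (comp_size hI) ((decides_lt Comp.var ht.lift).imp
      ((decides_isolated hI.lift Comp.var).imp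
        ((decides_effect_eq hI.lift
          (comp_act hI.lift Comp.var)
          (comp_act hI.lift ht.lift)).imp
          (decides_mem hU.lift Comp.var))))

theorem comp_after (hI : Comp e fun g => encInstance (I g).1) {c : ∀ g, (I g).Config}
    (hc : Comp e fun g => encConfig (c g)) {t : ∀ g, (I g).Task}
    (ht : Comp e fun g => Data.ofNat (t g)) : Comp e fun g => encConfig (after (c g) (t g)) :=
  have hs : Comp e fun g => encSet (c g).1 := hc.head
  have hU : Comp e fun g => encSet (c g).2 := hc.tail
  (comp_next hI (comp_act hI ht) hs).pair (comp_insert (comp_size hI) hU ht)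

/-- The search is polynomial because there are polynomially many canonical configurations. -/
theorem comp_configs (hI : Comp e fun g => encInstance (I g).1) :
    Comp e fun g => Data.ofList ((I g).configs.map encConfig) := by
  classical
  have hs : Comp (extend e fun g (c : (I g).Config) => encConfig c) fun p => Data.ofList
      (((I p.1).successors p.2).map encConfig) := by
    refine (Comp.map_filter (comp_size (I := fun p : Σ g, (I g).Config => I p.1) hI.lift).finRange
      (p := fun p t => Allowed p.2 t) (F := fun p t => encConfig (after p.2 t))
      ?_ ?_).of_eq fun p => ?_
    · exact decides_allowed hI.lift.lift Comp.var.lift Comp.var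
    · exact comp_after hI.lift.lift Comp.var.lift Comp.var
    · rw [successors, List.map_map]
      congr!
  have hn := (comp_size hI).polyBdd
  have hF := (comp_nF hI).polyBdd
  refine Comp.bfs (P := fun g c => Canonical c) (fun _ => encConfig_injective)
    (fun g => canonical_initial) (fun g c hc d hd => hc.of_mem_successors hd)
    (fun g => finite_canonical)
    (((PolyBdd.const k).mul ((hn.pow w).mul (hn.pow ((k + 1) ^ k)))).mono fun g => ?_)
    ⟨_, ((hF.mul (PolyBdd.const 4)).add (hn.mul (PolyBdd.const 4))).add (PolyBdd.const 3),
      fun g c _ => ?_⟩ ((comp_initial hI).pair ?_) hs (comp_size hI)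
  · have h : (I g).1.tn.size + 1 ≤ (Data.ofNat (I g).1.tn.size).size := by
      rw [Data.size_ofNat]
      omega
    exact (I g).ncard_canonical_le.trans (Nat.mul_le_mul_left k
      (Nat.mul_le_mul (Nat.pow_le_pow_left h _) (Nat.pow_le_pow_left h _)))
  · have h1 := size_encSet_le c.1
    have h2 := size_encSet_le c.2
    simp only [encConfig, Data.size, Data.size_ofNat]
    omega
  · exact comp_encSet (A := fun g => (∅ : Finset (I g).Task)) (comp_size hI)
      ((Decides.eq (h := fun _ => Data.nil) (Comp.nil.pair Comp.nil) Comp.nil).congr fun x => by simp)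

theorem comp_fixedCount (hI : Comp e fun g => encInstance (I g).1)
    {U : ∀ g, Finset (I g).Task} (hU : Comp e fun g => encSet (U g))
    {a : ∀ g, Fin (I g).1.D.nA} (ha : Comp e fun g => Data.ofNat (a g)) :
    Comp e fun g => Data.ofNat (fixedCount (U g) (a g)) := by
  classical
  refine (Comp.card_filter (comp_size hI)
    (p := fun g t => t ∈ U g ∧ ¬ (I g).Isolated t ∧ (I g).act t = a g) ?_).of_eq fun g => by
      rw [fixedCount]
  exact (decides_mem hU.lift Comp.var).and
    ((decides_isolated hI.lift Comp.var).not.and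
      (Decides.eq_of_injective (fun _ => ofNat_val_injective)
        (comp_act hI.lift Comp.var) ha.lift))

theorem decides_coversUpToExchange (hI : Comp e fun g => encInstance (I g).1)
    {S : ∀ g, Multiset (Fin (I g).1.D.nA)}
    (hS : Comp e fun g => encFun fun a => Data.ofNat ((S g).count a))
    {U : ∀ g, Finset (I g).Task} (hU : Comp e fun g => encSet (U g)) :
    Decides e fun g => CoversUpToExchange (S g) (U g) := by
  classical
  refine Decides.and (Decides.forall_fin (comp_nA hI) (Decides.le (Comp.get_ofFn hS.lift Comp.var)
    (Comp.card_filter (comp_size hI.lift) ?_)))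
    (Decides.forall_fin (comp_nA hI) (Decides.le
      (Comp.sum (comp_nA hI.lift) ?_)
      (Comp.card_filter (comp_size hI.lift) ?_)))
  · exact ((decides_isolated hI.lift.lift Comp.var).or
      (decides_mem hU.lift.lift Comp.var)).and
      (Decides.eq_of_injective (fun _ => ofNat_val_injective)
        (comp_act hI.lift.lift Comp.var) Comp.var.lift)
  · refine (Comp.ite (p := fun x : (Σ p : (Σ g, Fin (I g).1.D.nA), Fin (I p.1).1.D.nA) =>
      (I x.1.1).effect x.2 = (I x.1.1).effect x.1.2)
      (decides_effect_eq hI.lift.lift Comp.var Comp.var.lift)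
      ((Comp.get_ofFn hS.lift.lift Comp.var).sub
        (comp_fixedCount hI.lift.lift hU.lift.lift Comp.var))
      (Comp.ofNat_const 0)).of_eq fun x => ?_
    split_ifs <;> rfl
  · exact (decides_mem hU.lift.lift Comp.var).and
      ((decides_isolated hI.lift.lift Comp.var).and
        (decides_effect_eq hI.lift.lift
          (comp_act hI.lift.lift Comp.var) Comp.var.lift))

end BoundedInstance

end HTN

open WhileTree HTN BoundedInstance in
theorem mainTheorem4 (k w : ℕ) :
    WhileTree.PolyTimeSolvableOn HTN.encReachInstance
        (fun I => HTN.Bounded k w I.toInstance) HTN.StateReachability ∧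
      WhileTree.PolyTimeSolvableOn HTN.encActionInstance
        (fun I => HTN.Bounded k w I.toInstance) HTN.ActionExecutability ∧
      WhileTree.PolyTimeSolvableOn HTN.encInstance
        (HTN.Bounded k w) HTN.PlanExistence := by
  refine ⟨PolyTimeSolvableOn.of_decides ?_, PolyTimeSolvableOn.of_decides ?_,
    PolyTimeSolvableOn.of_decides ?_⟩
  · let I : {I : ReachInstance // Bounded k w I.toInstance} → BoundedInstance k w :=
      fun g => ⟨g.1.toInstance, g.2⟩
    have he : Comp (fun g : {I : ReachInstance // Bounded k w I.toInstance} =>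
      encReachInstance g.1) fun g => encReachInstance g.1 := Comp.id
    have hI : Comp (fun g : {I : ReachInstance // Bounded k w I.toInstance} =>
      encReachInstance g.1) fun g => encInstance (I g).1 := he.head
    have ht : Comp (fun g : {I : ReachInstance // Bounded k w I.toInstance} =>
      encReachInstance g.1) fun g => encSet g.1.target := he.tail
    refine (Decides.exists_mem (comp_configs hI) (p := fun g c => g.1.target ⊆ c.1) ?_).congr
      fun g => ?_
    · exact decides_subset (comp_nF hI.lift) ht.lift Comp.var.head
    · rw [← exists_reaches_iff_configs (I := I g) (fun s => g.1.target ⊆ s)]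
      exact ((I g).exists_solution_iff fun s _ => g.1.target ⊆ s).symm
  · let I : {I : ActionInstance // Bounded k w I.toInstance} → BoundedInstance k w :=
      fun g => ⟨g.1.toInstance, g.2⟩
    have he : Comp (fun g : {I : ActionInstance // Bounded k w I.toInstance} =>
      encActionInstance g.1) fun g => encActionInstance g.1 := Comp.id
    have hI : Comp (fun g : {I : ActionInstance // Bounded k w I.toInstance} =>
      encActionInstance g.1) fun g => encInstance (I g).1 := he.head
    have hS : Comp (fun g : {I : ActionInstance // Bounded k w I.toInstance} =>
      encActionInstance g.1) fun g => encFun fun a => Data.ofNat (g.1.S.count a) := he.tail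
    refine (Decides.exists_mem (comp_configs hI)
      (p := fun g c => CoversUpToExchange (I := I g) g.1.S c.2) ?_).congr fun g => ?_
    · exact decides_coversUpToExchange hI.lift hS.lift Comp.var.tail
    · rw [← exists_covering_iff_configs (I := I g) g.1.S]
      exact ((I g).exists_solution_iff fun _ p => g.1.S ≤ p).symm
  · have hI : Comp (fun g : BoundedInstance k w => encInstance g.1)
      fun g => encInstance g.1 := Comp.id
    refine (Decides.exists_mem (comp_configs (I := fun g => g) hI)
      (p := fun g c => ∀ t, t ∈ c.2) ?_).congr fun g => planExistence_iff_configs.symm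
    exact Decides.forall_fin (comp_size hI.lift)
      (decides_mem Comp.var.tail.lift Comp.var)
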